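/- **Theorem (regret bound for MinWD).** *Setting.* Let $\mathcal X\subseteq\mathbb R^{p}$ (contexts), $\mathcal A\subseteq\mathbb R^{r}$ (arms), $d=p+r\ge 1$, $\Phi=\mathcal X\times\mathcal A\subseteq\mathbb R^d$, and write $[x,a]\in\mathbb R^d$ for the concatenation. Let $\phi:\Phi\to\mathcal H$ be a feature map into a real Hilbert space with kernel $k(z,z')=\langle\phi(z),\phi(z')\rangle$, such that $\|\phi(z)\|\le 1$ on $\Phi$ and $\phi$ is $L_\phi$-Lipschitz on $\Phi$. The reward function is $f(x,a)=\langle\phi([x,a]),\theta\rangle$ with $\|\theta\|\le B$. Let $\lambda\ge 1$, $b\ge 0$, $\delta\in(0,1)$, let $\|\cdot\|$ be a norm on $\mathbb R^p$ and $\Delta$ a budget. In round $t=1,2,\dots$ the agent receives $\hat x_t$, selects $a_t\in\mathcal A$, and then observes the true context $x_t\in\mathcal B_\Delta(\hat x_t)=\{x\in\mathcal X:\|x-\hat x_t\|\le\Delta\}$ and the reward $y_t=f(x_t,a_t)+n_t$. There is a filtration $(\mathcal F_t)_{t\ge 0}$ such that $x_t,a_t$ are $\mathcal F_{t-1}$-measurable,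 $n_t$ is $\mathcal F_t$-measurable, and $\mathbb E[e^{\sigma n_t}\mid\mathcal F_{t-1}]\le e^{\sigma^2b^2/2}$ for all $\sigma\in\mathbb R$. *Algorithm.* Put $z_t=[x_t,a_t]$, $\mathbf K_t=(k(z_i,z_j))_{1\le i,j\le t-1}$, $\mathbf k_t(x,a)=(k([x,a],z_i))_{1\le i\le t-1}$, $\mathbf y_t=(y_i)_{1\le i\le t-1}$, and $$\hat f_t(x,a)=\mathbf k_t(x,a)^\top(\mathbf K_t+\lambda\mathbf I)^{-1}\mathbf y_t,\qquad s_t(x,a)^2=\tfrac1\lambda k([x,a],[x,a])-\tfrac1\lambda\mathbf k_t(x,a)^\top(\mathbf K_t+\lambda\mathbf I)^{-1}\mathbf k_t(x,a),$$ $$\gamma_t=\log\det(\mathbf I+\mathbf K_t/\lambda),\qquad h_t=\sqrt\lambda B+b\sqrt{\gamma_t-2\log\delta},\qquad U_t(x,a)=\hat f_t(x,a)+h_ts_t(x,a).$$ The UCB degradation is $D_{a,t}(x)=\sup_{a'\in\mathcal A}U_t(x,a')-U_t(x,a)$. MinWD selects in every round an arm $a_t\in\mathcal A$ that minimizes $\sup_{x\in\mathcal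 B_\Delta(\hat x_t)}D_{a,t}(x)$ over $a\in\mathcal A$. *Regret.* Let $r(x,a)=\sup_{a'\in\mathcal A}f(x,a')-f(x,a)$, $R_T=\sum_{t=1}^Tr(x_t,a_t)$, and let $MR_t=\inf_{a\in\mathcal A}\sup_{x\in\mathcal B_\Delta(\hat x_t)}r(x,a)$ be the optimal worst-case regret of an oracle that knows $f$. *Considered sequence.* As usual it is assumed that the following maximizers and minimizers exist: $\tilde a_t\in\mathcal A$ minimizes $\sup_{x\in\mathcal B_\Delta(\hat x_t)}r(x,a)$; $\dot x_t\in\mathcal B_\Delta(\hat x_t)$ maximizes $D_{\tilde a_t,t}$; $\dot a_t\in\mathcal A$ maximizes $U_t(\dot x_t,\cdot)$. Put $\dot z_t=[\dot x_t,\dot a_t]$. *Recurrence conditions for $T$ with constant $\kappa\ge0$.* Let $\varepsilon=(\kappa^2/T)^{1/(2d)}$ and $q=\lceil\kappa/\varepsilon^d\rceil$ (so that $\kappa/\varepsilon^d=\sqrt T$). There is a finite set $\Phi_\varepsilon\subseteq\Phi$ such that every point of $\Phi$ is within Euclidean distance $\varepsilon$ of $\Phi_\varepsilon$ and, with cells $\mathcal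 C(c)=\{z:\|z-c\|_2\le\varepsilon\}$, for every $c\in\Phi_\varepsilon$: (i) $z_t\in\mathcal C(c)$ for some $1\le t\le q$; (ii) whenever $z_t\in\mathcal C(c)$ for some $t\ge 1$, then $z_{t'}\in\mathcal C(c)$ for some $t<t'\le t+q$. *Ranks.* Let $\bar d=\bar d_T$ be the rank of the kernel matrix $(k(z_i,z_j))_{1\le i,j\le T}$ of the first $T$ rounds. Let $M=\lfloor T/q\rfloor$. A matching is a map $\zeta$ such that for all $1\le s\le Mq$ one has $s\le\zeta(s)<s+q$ and $\dot z_s,z_{\zeta(s)}$ lie in a common cell. The effective dimension $\tilde d=\tilde d(\zeta)$ is the largest, over $1\le l\le q$, of the ranks of the matrices $\big(k(z_{\zeta(l+iq)},z_{\zeta(l+jq)})\big)_{0\le i,j<M}$. *Claim.* There is an event of probability at least $1-\delta$ on which the following hold. 1. For every $T\ge1$ and $\kappa\ge0$ for which the recurrence conditions hold (with some covering $\Phi_\varepsilon$), a matching exists, and for every matching $$R_T\le\sum_{t=1}^TMR_t+2h_TT^{3/4}\sqrt{4\tilde d\log\Big(1+\frac{T}{\tilde d\lambda}\Big)+\frac1\lambda}+4\sqrt{\tfrac2\lambda}\,L_\phi\kappa^{1/d}h_TT^{1-\frac1{2d}}+2h_T\sqrt{2T\bar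 d\log\Big(1+\frac T{\bar d\lambda}\Big)}$$ (where $u\log(1+T/(u\lambda))$ is read as $0$ for $u=0$). 2. Consequently MinWD achieves Type-II robustness: if for one $\kappa\ge0$ the recurrence conditions hold for all sufficiently large $T$, and the ranks $\bar d_T$ are bounded in $T$, then $R_T-\sum_{t=1}^TMR_t\le g(T)$ for all $T$, for some $g$ with $g(T)=o(T)$. -/

import Mathlib

open MeasureTheory Filter Asymptotics
open scoped NNReal RealInnerProductSpace

noncomputable section

namespace RobustBandit

/-- Euclidean space `ℝⁿ`. -/
abbrev Vec (n : ℕ) : Type := EuclideanSpace ℝ (Fin n)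

/-- Context–arm vectors: `ℝᵖ × ℝʳ` with the Euclidean norm, i.e. `ℝᵈ` with `d = p + r`. -/
abbrev CtxArm (p r : ℕ) : Type := WithLp 2 (Vec p × Vec r)

/-- The concatenated vector `[x, a]`. -/
def concat {p r : ℕ} (x : Vec p) (a : Vec r) : CtxArm p r := WithLp.toLp 2 (x, a)

/-- The data of a kernelized contextual bandit with imperfect contexts, together with the parameters
of the algorithm. -/
structure Problem (p r : ℕ) (H : Type*) [NormedAddCommGroup H] [InnerProductSpace ℝ H] where
  /-- the context domain -/
  ctx : Set (Vec p)
  /-- the arm set -/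
  arms : Set (Vec r)
  /-- the feature map -/
  feat : CtxArm p r → H
  /-- the representation of the reward function -/
  theta : H
  /-- the norm that measures context errors -/
  ctxNorm : Seminorm ℝ (Vec p)
  /-- the defense budget -/
  budget : ℝ
  /-- the ridge parameter -/
  lam : ℝ
  /-- the bound on the reward function used in the confidence width -/
  B : ℝ
  /-- the sub-Gaussian parameter of the noise -/
  b : ℝ
  /-- the failure probability -/
  delta : ℝ

/-- One realization of the interaction. Rounds are numbered `1, 2, …`; the entries with index `0` are
never used. -/
structure Run (p r : ℕ) where
  /-- imperfect contexts -/
  xhat : ℕ → Vec p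
  /-- true contexts -/
  x : ℕ → Vec p
  /-- selected arms -/
  a : ℕ → Vec r
  /-- noise -/
  noise : ℕ → ℝ

/-- The true context–arm vector `[x_t, a_t]`. -/
def Run.z {p r : ℕ} (R : Run p r) (t : ℕ) : CtxArm p r := concat (R.x t) (R.a t)

namespace Problem

variable {p r : ℕ} {H : Type*} [NormedAddCommGroup H] [InnerProductSpace ℝ H]

/-- The context–arm space `Φ`, the product of the context domain and the arm set. -/
def space (P : Problem p r H) : Set (CtxArm p r) :=
  {z | ∃ x ∈ P.ctx, ∃ a ∈ P.arms, z = concat x a}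

/-- The kernel `k(z, z') = ⟨φ(z), φ(z')⟩`. -/
def kern (P : Problem p r H) (z w : CtxArm p r) : ℝ := ⟪P.feat z, P.feat w⟫

/-- The reward function `f(x, a) = ⟨φ(x, a), θ⟩`. -/
def f (P : Problem p r H) (x : Vec p) (a : Vec r) : ℝ := ⟪P.feat (concat x a), P.theta⟫

/-- The observed reward `y_t = f(x_t, a_t) + n_t`. -/
def y (P : Problem p r H) (R : Run p r) (t : ℕ) : ℝ := P.f (R.x t) (R.a t) + R.noise t

/-! ### Kernel ridge regression -/

/-- The matrix `K_t`, indexed by the rounds `1, …, t - 1`. -/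
def K (P : Problem p r H) (R : Run p r) (t : ℕ) :
    Matrix (Finset.Ico 1 t) (Finset.Ico 1 t) ℝ :=
  Matrix.of fun i j => P.kern (R.z i) (R.z j)

/-- The vector `k_t(x, a)`, indexed by the rounds `1, …, t - 1`. -/
def kvec (P : Problem p r H) (R : Run p r) (t : ℕ) (x : Vec p) (a : Vec r) :
    Finset.Ico 1 t → ℝ :=
  fun i => P.kern (concat x a) (R.z i)

/-- The ridge estimate `k_t(x, a)ᵀ (K_t + λ I)⁻¹ y_t`. -/
def fhat (P : Problem p r H) (R : Run p r) (t : ℕ) (x : Vec p) (a : Vec r) : ℝ :=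
  P.kvec R t x a ⬝ᵥ
    Matrix.mulVec (P.K R t + P.lam • (1 : Matrix (Finset.Ico 1 t) (Finset.Ico 1 t) ℝ))⁻¹
      (fun i : Finset.Ico 1 t => P.y R i)

/-- The confidence width `s_t(x, a)`. -/
def width (P : Problem p r H) (R : Run p r) (t : ℕ) (x : Vec p) (a : Vec r) : ℝ :=
  Real.sqrt ((1 / P.lam) * P.kern (concat x a) (concat x a) -
    (1 / P.lam) * (P.kvec R t x a ⬝ᵥ
      Matrix.mulVec (P.K R t + P.lam • (1 : Matrix (Finset.Ico 1 t) (Finset.Ico 1 t) ℝ))⁻¹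
        (P.kvec R t x a)))

/-- `γ_t = log det (I + K_t / λ)`. -/
def gamma (P : Problem p r H) (R : Run p r) (t : ℕ) : ℝ :=
  Real.log (1 + (1 / P.lam) • P.K R t).det

/-- `h_t = √λ B + b √(γ_t - 2 log δ)`. -/
def h (P : Problem p r H) (R : Run p r) (t : ℕ) : ℝ :=
  Real.sqrt P.lam * P.B + P.b * Real.sqrt (P.gamma R t - 2 * Real.log P.delta)

/-- The upper confidence bound `U_t(x, a)`. -/
def ucb (P : Problem p r H) (R : Run p r) (t : ℕ) (x : Vec p) (a : Vec r) : ℝ :=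
  P.fhat R t x a + P.h R t * P.width R t x a

/-! ### Degradation, regret and the algorithm -/

/-- The defense region at round `t`: the contexts within the budget of the imperfect context. -/
def region (P : Problem p r H) (R : Run p r) (t : ℕ) : Set (Vec p) :=
  {x | x ∈ P.ctx ∧ P.ctxNorm (x - R.xhat t) ≤ P.budget}

/-- The UCB degradation: the largest UCB at context `x` minus the UCB of arm `a` there. -/
def degradation (P : Problem p r H) (R : Run p r) (t : ℕ) (a : Vec r) (x : Vec p) : ℝ :=
  (⨆ a' : P.arms, P.ucb R t x a') - P.ucb R t x a

/-- The worst-case degradation of arm `a` over the defense region. -/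
def worstDegradation (P : Problem p r H) (R : Run p r) (t : ℕ) (a : Vec r) : ℝ :=
  ⨆ x : P.region R t, P.degradation R t a x

/-- The instantaneous regret of arm `a` at context `x`. -/
def regret (P : Problem p r H) (x : Vec p) (a : Vec r) : ℝ :=
  (⨆ a' : P.arms, P.f x a') - P.f x a

/-- The worst-case regret of arm `a` over the defense region. -/
def worstRegret (P : Problem p r H) (R : Run p r) (t : ℕ) (a : Vec r) : ℝ :=
  ⨆ x : P.region R t, P.regret x a

/-- The optimal worst-case regret `MR_t`. -/
def MR (P : Problem p r H) (R : Run p r) (t : ℕ) : ℝ :=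
  ⨅ a : P.arms, P.worstRegret R t a

/-- The cumulative true regret `R_T`. -/
def cumRegret (P : Problem p r H) (R : Run p r) (T : ℕ) : ℝ :=
  ∑ t ∈ Finset.Icc 1 T, P.regret (R.x t) (R.a t)

/-- The arms of the run are selected by MinWD: at every round the selected arm minimizes the
worst-case degradation. -/
def IsMinWD (P : Problem p r H) (R : Run p r) : Prop :=
  ∀ t, 1 ≤ t → R.a t ∈ P.arms ∧
    ∀ a ∈ P.arms, P.worstDegradation R t (R.a t) ≤ P.worstDegradation R t a

/-- The sequence `(xd t, ad t)` is a considered sequence of the run: with `at_` an arm that minimizes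
the worst-case regret at round `t`, `xd t` is a context in the defense region that maximizes the
degradation of `at_`, and `ad t` is a UCB-optimal arm at the context `xd t`. -/
def IsConsidered (P : Problem p r H) (R : Run p r) (xd : ℕ → Vec p) (ad : ℕ → Vec r) : Prop :=
  ∀ t, 1 ≤ t →
    (∃ at_ ∈ P.arms,
      (∀ a ∈ P.arms, P.worstRegret R t at_ ≤ P.worstRegret R t a) ∧
      xd t ∈ P.region R t ∧
      ∀ x ∈ P.region R t, P.degradation R t at_ x ≤ P.degradation R t at_ (xd t)) ∧
    ad t ∈ P.arms ∧ ∀ a ∈ P.arms, P.ucb R t (xd t) a ≤ P.ucb R t (xd t) (ad t)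

/-- Type-II robustness: the difference between the cumulative true regret and the cumulative optimal
worst-case regret is at most sub-linear. -/
def TypeIIRobust (P : Problem p r H) (R : Run p r) : Prop :=
  ∃ g : ℕ → ℝ, g =o[atTop] (fun T : ℕ => (T : ℝ)) ∧
    ∀ T : ℕ, P.cumRegret R T - ∑ t ∈ Finset.Icc 1 T, P.MR R t ≤ g T

/-- The rank `d̄` of the kernel matrix of the rounds `1, …, T`. -/
def dbar (P : Problem p r H) (R : Run p r) (T : ℕ) : ℕ := (P.K R (T + 1)).rank

/-- The effective dimension `d̃`. With `M = ⌊T / q⌋`, the rounds `1, …, M q` are split into the groups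
`{l, l + q, …, l + (M - 1) q}`, `1 ≤ l ≤ q`; the rank for the group `l` is that of the kernel matrix
of the true context–arm vectors at the matched rounds `ζ(t)`, `t` in the group; `d̃` is the largest of
these ranks. -/
def dtilde (P : Problem p r H) (R : Run p r) (q T : ℕ) (ζ : ℕ → ℕ) : ℕ :=
  (Finset.Icc 1 q).sup fun l =>
    (Matrix.of fun i j : Fin (T / q) =>
      P.kern (R.z (ζ (l + i * q))) (R.z (ζ (l + j * q)))).rank

end Problem

/-! ### Coverings and recurrence -/

/-- The finite set `C` is an `ε`-covering of `S` by points of `S`. -/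
def IsCovering {p r : ℕ} (S : Set (CtxArm p r)) (ε : ℝ) (C : Finset (CtxArm p r)) : Prop :=
  (C : Set (CtxArm p r)) ⊆ S ∧ ∀ z ∈ S, ∃ c ∈ C, ‖z - c‖ ≤ ε

/-- The number of rounds `⌈κ / ε ^ d⌉` within which every cell is visited. -/
def period (d : ℕ) (κ ε : ℝ) : ℕ := ⌈κ / ε ^ d⌉₊

/-- The two recurrence conditions for the sequence `z` of true context–arm vectors: every cell is
visited within the first `⌈κ / ε ^ d⌉` rounds, and after each visit to a cell the next visit to it
takes place at most `⌈κ / ε ^ d⌉` rounds later. -/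
def IsRecurrent {p r : ℕ} (κ ε : ℝ) (C : Finset (CtxArm p r)) (z : ℕ → CtxArm p r) : Prop :=
  (∀ c ∈ C, ∃ t, 1 ≤ t ∧ t ≤ period (p + r) κ ε ∧ ‖z t - c‖ ≤ ε) ∧
  ∀ c ∈ C, ∀ t, 1 ≤ t → ‖z t - c‖ ≤ ε →
    ∃ t', t < t' ∧ t' ≤ t + period (p + r) κ ε ∧ ‖z t' - c‖ ≤ ε

/-- The scale `ε = (κ² / T)^(1 / (2 d))`, for which `κ / ε ^ d = √T`. -/
def scale (d : ℕ) (κ : ℝ) (T : ℕ) : ℝ := (κ ^ 2 / (T : ℝ)) ^ (1 / (2 * (d : ℝ)))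

/-- `ζ` matches every round `s` in `1, …, ⌊T / q⌋ q` with a round `ζ(s)` in `s, …, s + q - 1` whose
true context–arm vector lies in a common cell with the considered one of round `s`. -/
def IsMatching {p r : ℕ} (ε : ℝ) (C : Finset (CtxArm p r)) (z zd : ℕ → CtxArm p r) (q T : ℕ)
    (ζ : ℕ → ℕ) : Prop :=
  ∀ s, 1 ≤ s → s ≤ T / q * q → s ≤ ζ s ∧ ζ s < s + q ∧
    ∃ c ∈ C, ‖zd s - c‖ ≤ ε ∧ ‖z (ζ s) - c‖ ≤ ε

/-! ### The probabilistic model -/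

/-- The stochastic assumptions: true contexts and selected arms are known before the noise of the same
round, and given that past the noise is `b`-sub-Gaussian. -/
structure IsSubGaussianModel {p r : ℕ} {Ω : Type*} {mΩ : MeasurableSpace Ω} (μ : Measure Ω)
    (ℱ : Filtration ℕ mΩ) (b : ℝ) (R : Ω → Run p r) : Prop where
  measurable_x : ∀ t, Measurable[ℱ t] fun ω => (R ω).x (t + 1)
  measurable_a : ∀ t, Measurable[ℱ t] fun ω => (R ω).a (t + 1)
  measurable_noise : ∀ t, Measurable[ℱ (t + 1)] fun ω => (R ω).noise (t + 1)
  integrable_exp : ∀ t, ∀ σ : ℝ, Integrable (fun ω => Real.exp (σ * (R ω).noise (t + 1))) μ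
  subGaussian : ∀ t, ∀ σ : ℝ,
    μ[fun ω => Real.exp (σ * (R ω).noise (t + 1)) | ℱ t] ≤ᵐ[μ]
      fun _ => Real.exp (σ ^ 2 * b ^ 2 / 2)

end RobustBandit

end

/-!
On a run on which the self-normalized noise `‖S‖²_{V⁻¹} ≤ b² (γ - 2 log δ)` is controlled in all
rounds, the reward function lies within `h_t s_t` of its ridge estimate, and the theorem is
deterministic.

*The confidence event* (`measure_selfNormalized_ge`). The regularized covariance
`V = λ + ∑ φ(z_i) ⊗ φ(z_i)` acts on a Hilbert space that need not be finite-dimensional, so the method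
of mixtures is not run with a Gaussian measure on that space. Instead `V⁻¹` is built by rank-one
updates (`covInv`), and one update changes
`exp (‖S‖²_{V⁻¹} / (2 b²)) / √det (1 + K / λ)` by a factor that is the mixture of
`exp (ξ η - ξ² / 2)` over a one-dimensional Gaussian `ξ` whose mean and variance are known before the
noise `η` of the round (`lintegral_gaussian_mixture`, `mixture_succ`). Hence this process is a
supermartingale, and Ville's inequality (`measure_exists_ge_le`) gives the bound for all rounds at
once. Only scalar quantities `⟪φ(z_i), V⁻¹ φ(z_j)⟫` need to be measurable.

*One round* (`Problem.regret_le`). Optimism compares the regret of the selected arm with its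
degradation, the choice of the arm compares this with the degradation of the minimax arm, whose worst
case is attained at the considered context, and optimism again compares it with `MR_t`. The price
is `2 h_t` times the sum of the confidence widths at the true and at the considered vector.

*Summing up.* At the true vectors the squared widths telescope to a log-determinant
(`sum_inner_covInv_le`), which is bounded through rank and trace (`log_det_le_rankLog`). The
considered vectors are never observed, but recurrence provides a true vector in the same cell within
one period (`IsRecurrent.exists_visit`). The rounds are split into residue classes modulo the period;
inside one class the matched rounds are increasing and precede the next round of the class, so the
log-determinant bound applies to the matched vectors alone, at the cost of the cell diameter
(`Problem.sum_group_le`). With period `⌈√T⌉`, Cauchy–Schwarz gives the exponents `3 / 4` and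
`1 - 1 / (2 d)`; the constants survive the rounding by `ceil_sqrt_mul_log_le`. When the ranks are
bounded, `h_T` and the log-determinant terms are polylogarithmic in `T` and the bound is `o(T)`.
-/

/-! ### Inverse covariance and ridge regression -/

namespace RobustBandit

section Covariance

variable {H : Type*} [NormedAddCommGroup H] [InnerProductSpace ℝ H]

/-- The regularized covariance operator `u ↦ λ u + ∑ i, ⟪v i, u⟫ v i` of a finite family. -/
noncomputable def cov {ι : Type*} (lam : ℝ) (s : Finset ι) (v : ι → H) (u : H) : H :=
  lam • u + ∑ i ∈ s, ⟪v i, u⟫ • v i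

/-- The inverse of the regularized covariance operator of `v 0, …, v (n - 1)`, defined by the
Sherman–Morrison rank-one updates; `cov_covInv` and `covInv_cov` show that it is the inverse. -/
noncomputable def covInv (lam : ℝ) (v : ℕ → H) : ℕ → H →ₗ[ℝ] H
  | 0 => lam⁻¹ • LinearMap.id
  | n + 1 => covInv lam v n -
      (1 + ⟪v n, covInv lam v n (v n)⟫)⁻¹ •
        ((innerₗ H (covInv lam v n (v n))).smulRight (covInv lam v n (v n)))

lemma covInv_zero (lam : ℝ) (v : ℕ → H) (u : H) : covInv lam v 0 u = lam⁻¹ • u := rfl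

lemma covInv_succ (lam : ℝ) (v : ℕ → H) (n : ℕ) (u : H) :
    covInv lam v (n + 1) u = covInv lam v n u -
      ((1 + ⟪v n, covInv lam v n (v n)⟫)⁻¹ * ⟪covInv lam v n (v n), u⟫) •
        covInv lam v n (v n) := by
  simp [covInv, smul_smul]

lemma cov_sub {ι : Type*} (lam : ℝ) (s : Finset ι) (v : ι → H) (u w : H) :
    cov lam s v (u - w) = cov lam s v u - cov lam s v w := by
  simp only [cov, smul_sub, inner_sub_right, sub_smul, Finset.sum_sub_distrib]
  abel

lemma cov_smul {ι : Type*} (lam : ℝ) (s : Finset ι) (v : ι → H) (c : ℝ) (u : H) :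
    cov lam s v (c • u) = c • cov lam s v u := by
  simp only [cov, smul_add, inner_smul_right, Finset.smul_sum, smul_smul, mul_comm c]

lemma inner_cov_self {ι : Type*} (lam : ℝ) (s : Finset ι) (v : ι → H) (u : H) :
    ⟪u, cov lam s v u⟫ = lam * ‖u‖ ^ 2 + ∑ i ∈ s, ⟪v i, u⟫ ^ 2 := by
  simp only [cov, inner_add_right, inner_smul_right, inner_sum, real_inner_self_eq_norm_sq]
  congr 1
  refine Finset.sum_congr rfl fun i _ => ?_
  rw [real_inner_comm u (v i)]; ring

lemma cov_injective {ι : Type*} {lam : ℝ} (hlam : 0 < lam) (s : Finset ι) (v : ι → H) :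
    Function.Injective (cov lam s v) := by
  intro u w h
  have h0 : cov lam s v (u - w) = 0 := by rw [cov_sub, h, sub_self]
  have h1 := inner_cov_self lam s v (u - w)
  rw [h0, inner_zero_right] at h1
  have h2 : 0 ≤ ∑ i ∈ s, ⟪v i, u - w⟫ ^ 2 := Finset.sum_nonneg fun i _ => sq_nonneg _
  have h3 : ‖u - w‖ ^ 2 = 0 := by
    have := sq_nonneg ‖u - w‖
    nlinarith
  exact sub_eq_zero.1 (norm_eq_zero.1 (pow_eq_zero_iff (two_ne_zero) |>.1 h3))

lemma covInv_symm (lam : ℝ) (v : ℕ → H) (n : ℕ) (u w : H) :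
    ⟪covInv lam v n u, w⟫ = ⟪u, covInv lam v n w⟫ := by
  induction n generalizing u w with
  | zero => simp [covInv_zero, inner_smul_left, inner_smul_right]
  | succ n ih =>
    simp only [covInv_succ, inner_sub_left, inner_sub_right, inner_smul_left, inner_smul_right, ih,
      RCLike.conj_to_real]
    rw [← ih u (v n), real_inner_comm (v n) (covInv lam v n u)]
    ring

lemma cov_range_succ (lam : ℝ) (v : ℕ → H) (n : ℕ) (u : H) :
    cov lam (Finset.range (n + 1)) v u = cov lam (Finset.range n) v u + ⟪v n, u⟫ • v n := by
  simp only [cov, Finset.sum_range_succ]; abel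

lemma cov_covInv {lam : ℝ} (hlam : 0 < lam) (v : ℕ → H) (n : ℕ) (u : H) :
    cov lam (Finset.range n) v (covInv lam v n u) = u := by
  induction n generalizing u with
  | zero => simp [cov, covInv_zero, smul_smul, hlam.ne']
  | succ n ih =>
    have hpos : 0 ≤ ⟪v n, covInv lam v n (v n)⟫ := by
      have h1 := inner_cov_self lam (Finset.range n) v (covInv lam v n (v n))
      rw [ih, real_inner_comm] at h1
      rw [h1]
      exact add_nonneg (by positivity) (Finset.sum_nonneg fun i _ => sq_nonneg _)
    rw [cov_range_succ, covInv_succ, cov_sub, cov_smul, ih, ih, inner_sub_right, inner_smul_right,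
      covInv_symm lam v n (v n) u]
    set s := ⟪v n, covInv lam v n (v n)⟫
    set m := ⟪v n, covInv lam v n u⟫
    have : m - (1 + s)⁻¹ * m * s = (1 + s)⁻¹ * m := by field_simp; ring
    rw [this, sub_add_cancel]

lemma covInv_cov {lam : ℝ} (hlam : 0 < lam) (v : ℕ → H) (n : ℕ) (u : H) :
    covInv lam v n (cov lam (Finset.range n) v u) = u :=
  cov_injective hlam _ _ (cov_covInv hlam v n _)

lemma inner_covInv_self_nonneg {lam : ℝ} (hlam : 0 < lam) (v : ℕ → H) (n : ℕ) (u : H) :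
    0 ≤ ⟪u, covInv lam v n u⟫ := by
  have h1 := inner_cov_self lam (Finset.range n) v (covInv lam v n u)
  rw [cov_covInv hlam, real_inner_comm] at h1
  rw [h1]
  exact add_nonneg (by positivity) (Finset.sum_nonneg fun i _ => sq_nonneg _)

/-- The inverse covariance is antitone: enlarging the family of vectors shrinks the quadratic form.
The reason is the variational formula `⟪u, V⁻¹ u⟫ = sup_w (2 ⟪u, w⟫ - ⟪w, V w⟫)`. -/
lemma inner_covInv_le {lam : ℝ} (hlam : 0 < lam) (v v' : ℕ → H) (n n' : ℕ)
    (h : ∀ w : H, ∑ i ∈ Finset.range n', ⟪v' i, w⟫ ^ 2 ≤ ∑ i ∈ Finset.range n, ⟪v i, w⟫ ^ 2)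
    (u : H) : ⟪u, covInv lam v n u⟫ ≤ ⟪u, covInv lam v' n' u⟫ := by
  set w := covInv lam v n u
  set w' := covInv lam v' n' u
  have h1 := inner_cov_self lam (Finset.range n) v w
  have h2 := inner_cov_self lam (Finset.range n') v' w
  have h3 := inner_cov_self lam (Finset.range n') v' (w' - w)
  rw [cov_covInv hlam] at h1
  rw [cov_sub, cov_covInv hlam, inner_sub_left, inner_sub_right, inner_sub_right] at h3
  have h4 : ⟪w', cov lam (Finset.range n') v' w⟫ = ⟪u, w⟫ := by
    change ⟪covInv lam v' n' u, _⟫ = _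
    rw [covInv_symm, covInv_cov hlam]
  have h5 : 0 ≤ lam * ‖w' - w‖ ^ 2 + ∑ i ∈ Finset.range n', ⟪v' i, w' - w⟫ ^ 2 :=
    add_nonneg (by positivity) (Finset.sum_nonneg fun i _ => sq_nonneg _)
  rw [real_inner_comm] at h1
  rw [real_inner_comm u w'] at h3
  rw [real_inner_comm u w] at h3
  have := h w
  linarith

lemma inner_covInv_self_le {lam : ℝ} (hlam : 0 < lam) (v : ℕ → H) (n : ℕ) (u : H) :
    ⟪u, covInv lam v n u⟫ ≤ lam⁻¹ * ‖u‖ ^ 2 := by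
  have := inner_covInv_le hlam v v n 0
    (fun w => by simpa using Finset.sum_nonneg fun i _ => sq_nonneg _) u
  simpa [covInv_zero, inner_smul_right, real_inner_self_eq_norm_sq] using this

/-- The seminorm `√⟪u, V⁻¹ u⟫` attached to the inverse covariance. -/
noncomputable def covNorm (lam : ℝ) (v : ℕ → H) (n : ℕ) (u : H) : ℝ :=
  √⟪u, covInv lam v n u⟫

lemma covNorm_nonneg (lam : ℝ) (v : ℕ → H) (n : ℕ) (u : H) : 0 ≤ covNorm lam v n u :=
  Real.sqrt_nonneg _

lemma covNorm_sq {lam : ℝ} (hlam : 0 < lam) (v : ℕ → H) (n : ℕ) (u : H) :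
    covNorm lam v n u ^ 2 = ⟪u, covInv lam v n u⟫ :=
  Real.sq_sqrt (inner_covInv_self_nonneg hlam v n u)

lemma covNorm_le {lam : ℝ} (hlam : 0 < lam) (v : ℕ → H) (n : ℕ) (u : H) :
    covNorm lam v n u ≤ (√lam)⁻¹ * ‖u‖ := by
  refine Real.sqrt_le_iff.2 ⟨by positivity, ?_⟩
  rw [mul_pow, inv_pow, Real.sq_sqrt hlam.le]
  exact inner_covInv_self_le hlam v n u

lemma abs_inner_covInv_le {lam : ℝ} (hlam : 0 < lam) (v : ℕ → H) (n : ℕ) (u w : H) :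
    |⟪u, covInv lam v n w⟫| ≤ covNorm lam v n u * covNorm lam v n w := by
  -- The quadratic polynomial `t ↦ ⟪u + t w, V⁻¹ (u + t w)⟫` is nonnegative.
  have key : ∀ t : ℝ, 0 ≤ ⟪w, covInv lam v n w⟫ * (t * t) + 2 * ⟪u, covInv lam v n w⟫ * t +
      ⟪u, covInv lam v n u⟫ := by
    intro t
    have h := inner_covInv_self_nonneg hlam v n (u + t • w)
    rw [map_add, map_smul, inner_add_left, inner_add_right, inner_add_right, inner_smul_left,
      inner_smul_right, inner_smul_left, inner_smul_right, ← covInv_symm lam v n w u,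
      real_inner_comm u] at h
    simp only [RCLike.conj_to_real] at h
    linarith
  have hd := discrim_le_zero key
  rw [discrim] at hd
  rw [covNorm, covNorm, ← Real.sqrt_mul (inner_covInv_self_nonneg hlam v n u)]
  refine Real.le_sqrt_of_sq_le ?_
  rw [sq_abs]
  linarith

lemma covNorm_add_le {lam : ℝ} (hlam : 0 < lam) (v : ℕ → H) (n : ℕ) (u w : H) :
    covNorm lam v n (u + w) ≤ covNorm lam v n u + covNorm lam v n w := by
  refine Real.sqrt_le_iff.2 ⟨add_nonneg (covNorm_nonneg ..) (covNorm_nonneg ..), ?_⟩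
  rw [map_add, inner_add_left, inner_add_right, inner_add_right, ← covInv_symm lam v n w u,
      real_inner_comm u, add_sq, covNorm_sq hlam, covNorm_sq hlam]
  have := (le_abs_self _).trans (abs_inner_covInv_le hlam v n u w)
  linarith

lemma covNorm_mono {lam : ℝ} (hlam : 0 < lam) (v v' : ℕ → H) (n n' : ℕ)
    (h : ∀ w : H, ∑ i ∈ Finset.range n', ⟪v' i, w⟫ ^ 2 ≤ ∑ i ∈ Finset.range n, ⟪v i, w⟫ ^ 2)
    (u : H) : covNorm lam v n u ≤ covNorm lam v' n' u :=
  Real.sqrt_le_sqrt (inner_covInv_le hlam v v' n n' h u)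

end Covariance

section Ridge

variable {H : Type*} [NormedAddCommGroup H] [InnerProductSpace ℝ H]
  {ι : Type*} [Fintype ι]

lemma gram_mulVec (w : ι → H) (c : ι → ℝ) (i : ι) :
    (Matrix.gram ℝ w).mulVec c i = ⟪w i, ∑ j, c j • w j⟫ := by
  simp [Matrix.mulVec, dotProduct, inner_sum, inner_smul_right, Matrix.gram_apply, mul_comm]

variable [DecidableEq ι]

lemma isUnit_gram_add_smul {lam : ℝ} (hlam : 0 < lam) (w : ι → H) :
    IsUnit (Matrix.gram ℝ w + lam • (1 : Matrix ι ι ℝ)).det := by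
  have h : (Matrix.gram ℝ w + lam • (1 : Matrix ι ι ℝ)).PosDef :=
    Matrix.PosDef.posSemidef_add (Matrix.posSemidef_gram ℝ w) (Matrix.PosDef.one.smul hlam)
  exact h.det_pos.ne'.isUnit

lemma gram_add_smul_mulVec_inv {lam : ℝ} (hlam : 0 < lam) (w : ι → H) (c : ι → ℝ) :
    (Matrix.gram ℝ w + lam • (1 : Matrix ι ι ℝ)).mulVec
      ((Matrix.gram ℝ w + lam • (1 : Matrix ι ι ℝ))⁻¹.mulVec c) = c := by
  rw [Matrix.mulVec_mulVec, Matrix.mul_nonsing_inv _ (isUnit_gram_add_smul hlam w),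
    Matrix.one_mulVec]

/-- The push-through identity: applying the covariance to a combination of the family amounts to
applying the regularized Gram matrix to the coefficients. -/
lemma cov_sum_smul (lam : ℝ) (w : ι → H) (c : ι → ℝ) :
    cov lam Finset.univ w (∑ i, c i • w i) =
      ∑ i, (Matrix.gram ℝ w + lam • (1 : Matrix ι ι ℝ)).mulVec c i • w i := by
  simp only [cov, Matrix.add_mulVec, Pi.add_apply, gram_mulVec, Matrix.smul_mulVec,
    Matrix.one_mulVec, Pi.smul_apply, add_smul, Finset.sum_add_distrib, Finset.smul_sum, smul_smul,
    smul_eq_mul]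
  rw [add_comm]

/-- The primal and the dual form of the ridge estimate agree. -/
lemma inner_covInv_sum {lam : ℝ} (hlam : 0 < lam) (w : ι → H) (v : ℕ → H) (n : ℕ)
    (hv : ∀ u, cov lam (Finset.range n) v u = cov lam Finset.univ w u) (u : H) (c : ι → ℝ) :
    (fun i => ⟪u, w i⟫) ⬝ᵥ
      (Matrix.gram ℝ w + lam • (1 : Matrix ι ι ℝ))⁻¹.mulVec c =
        ⟪u, covInv lam v n (∑ i, c i • w i)⟫ := by
  have h : covInv lam v n (∑ i, c i • w i) =
      ∑ i, ((Matrix.gram ℝ w + lam • (1 : Matrix ι ι ℝ))⁻¹.mulVec c) i • w i := by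
    rw [← covInv_cov hlam v n (∑ i, ((Matrix.gram ℝ w + lam • (1 : Matrix ι ι ℝ))⁻¹.mulVec c) i •
      w i), hv, cov_sum_smul, gram_add_smul_mulVec_inv hlam]
  rw [h, inner_sum]
  simp [dotProduct, inner_smul_right, mul_comm]

/-- The kernel expression of the squared confidence width is the inverse covariance form. -/
lemma inner_covInv_eq {lam : ℝ} (hlam : 0 < lam) (w : ι → H) (v : ℕ → H) (n : ℕ)
    (hv : ∀ u, cov lam (Finset.range n) v u = cov lam Finset.univ w u) (u : H) :
    (1 / lam) * ⟪u, u⟫ - (1 / lam) * ((fun i => ⟪u, w i⟫) ⬝ᵥ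
      (Matrix.gram ℝ w + lam • (1 : Matrix ι ι ℝ))⁻¹.mulVec (fun i => ⟪u, w i⟫)) =
        ⟪u, covInv lam v n u⟫ := by
  rw [inner_covInv_sum hlam w v n hv]
  have h1 : ∑ i, ⟪u, w i⟫ • w i = cov lam (Finset.range n) v u - lam • u := by
    rw [hv, cov, add_sub_cancel_left]
    exact Finset.sum_congr rfl fun i _ => by rw [real_inner_comm]
  rw [h1, map_sub, covInv_cov hlam, map_smul, inner_sub_right, inner_smul_right]
  field_simp
  ring

end Ridge

end RobustBandit

/-! ### Log-determinants of Gram matrices -/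

namespace RobustBandit

section LogDet

variable {H : Type*} [NormedAddCommGroup H] [InnerProductSpace ℝ H]

lemma cov_fin (lam : ℝ) (v : ℕ → H) (n : ℕ) (u : H) :
    cov lam (Finset.range n) v u = cov lam Finset.univ (fun i : Fin n => v i) u := by
  simp only [cov, Finset.sum_range]

lemma det_gram_add_smul {lam : ℝ} (hlam : 0 < lam) (v : ℕ → H) (n : ℕ) :
    (Matrix.gram ℝ (fun i : Fin n => v i) + lam • (1 : Matrix (Fin n) (Fin n) ℝ)).det =
      ∏ i ∈ Finset.range n, (lam * (1 + ⟪v i, covInv lam v i (v i)⟫)) := by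
  induction n with
  | zero => simp
  | succ n ih =>
    set A := Matrix.gram ℝ (fun i : Fin n => v i) + lam • (1 : Matrix (Fin n) (Fin n) ℝ) with hA
    have hblock : (Matrix.gram ℝ (fun i : Fin (n + 1) => v i) +
        lam • (1 : Matrix (Fin (n + 1)) (Fin (n + 1)) ℝ)).submatrix finSumFinEquiv finSumFinEquiv =
        Matrix.fromBlocks A (Matrix.of fun i (_ : Fin 1) => ⟪v n, v i⟫)
          (Matrix.of fun (_ : Fin 1) i => ⟪v n, v i⟫)
          (Matrix.of fun (_ : Fin 1) (_ : Fin 1) => ⟪v n, v n⟫ + lam) := by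
      ext i j
      rcases i with i | i <;> rcases j with j | j
      · simp [hA, Matrix.gram_apply, Matrix.one_apply]
      · have h1 : Fin.castAdd 1 i ≠ Fin.natAdd n j := by
          intro h; have := congrArg Fin.val h; simp at this; omega
        simp [Matrix.gram_apply, h1, real_inner_comm]
      · have h1 : Fin.natAdd n i ≠ Fin.castAdd 1 j := by
          intro h; have := congrArg Fin.val h; simp at this; omega
        simp [Matrix.gram_apply, h1]
      · have h1 : i = j := Subsingleton.elim _ _
        simp [Matrix.gram_apply, h1]
    have : Invertible A := Matrix.invertibleOfIsUnitDet A (isUnit_gram_add_smul hlam _)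
    rw [← Matrix.det_submatrix_equiv_self finSumFinEquiv, hblock, Matrix.det_fromBlocks₁₁, ih,
      Finset.prod_range_succ]
    congr 1
    have h1 := inner_covInv_eq hlam (fun i : Fin n => v i) v n (cov_fin lam v n) (v n)
    rw [← h1, Matrix.det_fin_one, Matrix.sub_apply, Matrix.mul_assoc, Matrix.mul_apply,
      Matrix.invOf_eq_nonsing_inv]
    have h2 : ∑ j, (Matrix.of fun (_ : Fin 1) (i : Fin n) => ⟪v n, v i⟫) 0 j *
        (A⁻¹ * Matrix.of fun (i : Fin n) (_ : Fin 1) => ⟪v n, v i⟫) j 0 =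
        (fun i : Fin n => ⟪v n, v i⟫) ⬝ᵥ A⁻¹.mulVec (fun i : Fin n => ⟪v n, v i⟫) := by
      simp [dotProduct, Matrix.mulVec, Matrix.mul_apply]
    rw [h2, Matrix.of_apply]
    field_simp
    ring

lemma log_det_one_add_gram {lam : ℝ} (hlam : 0 < lam) (v : ℕ → H) (n : ℕ) :
    Real.log (1 + (1 / lam) • Matrix.gram ℝ (fun i : Fin n => v i)).det =
      ∑ i ∈ Finset.range n, Real.log (1 + ⟪v i, covInv lam v i (v i)⟫) := by
  have h1 : 1 + (1 / lam) • Matrix.gram ℝ (fun i : Fin n => v i) =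
      (1 / lam) • (Matrix.gram ℝ (fun i : Fin n => v i) +
        lam • (1 : Matrix (Fin n) (Fin n) ℝ)) := by
    rw [smul_add, smul_smul, one_div, inv_mul_cancel₀ hlam.ne', one_smul, add_comm]
  rw [h1, Matrix.det_smul, det_gram_add_smul hlam, Finset.prod_mul_distrib, Finset.prod_const,
    Finset.card_range, Fintype.card_fin, ← mul_assoc, ← mul_pow, one_div,
    inv_mul_cancel₀ hlam.ne', one_pow, one_mul, Real.log_prod]
  intro i _
  have := inner_covInv_self_nonneg hlam v i (v i)
  positivity

/-- The elliptical potential bound: the squared confidence widths of successive vectors sum to at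
most twice the logarithm of the determinant. -/
lemma sum_inner_covInv_le {lam : ℝ} (hlam : 1 ≤ lam) (v : ℕ → H) (n : ℕ)
    (hv : ∀ i < n, ‖v i‖ ≤ 1) :
    ∑ i ∈ Finset.range n, ⟪v i, covInv lam v i (v i)⟫ ≤
      2 * Real.log (1 + (1 / lam) • Matrix.gram ℝ (fun i : Fin n => v i)).det := by
  have hlam0 : 0 < lam := by linarith
  rw [log_det_one_add_gram hlam0, Finset.mul_sum]
  refine Finset.sum_le_sum fun i hi => ?_
  have h0 := inner_covInv_self_nonneg hlam0 v i (v i)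
  have h1 : ⟪v i, covInv lam v i (v i)⟫ ≤ 1 := by
    refine (inner_covInv_self_le hlam0 v i (v i)).trans ?_
    have h2 := hv i (Finset.mem_range.1 hi)
    have h3 : ‖v i‖ ^ 2 ≤ 1 := pow_le_one₀ (norm_nonneg _) h2
    have h4 : lam⁻¹ ≤ 1 := inv_le_one_of_one_le₀ hlam
    calc lam⁻¹ * ‖v i‖ ^ 2 ≤ 1 * 1 := by gcongr
      _ = 1 := one_mul 1
  set x := ⟪v i, covInv lam v i (v i)⟫
  -- On `[0, 1]` the bound `1 - 1 / y ≤ log y` at `y = 1 + x` gives `x ≤ 2 log (1 + x)`.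
  have h2 := Real.one_sub_inv_le_log_of_pos (show 0 < 1 + x by linarith)
  have h3 : x / 2 ≤ 1 - (1 + x)⁻¹ := by
    have : 1 - (1 + x)⁻¹ = x / (1 + x) := by field_simp; ring
    rw [this]
    gcongr
    linarith
  linarith

lemma det_one_add_smul_eq_prod {ι : Type*} [Fintype ι] [DecidableEq ι] {G : Matrix ι ι ℝ}
    (hG : G.IsHermitian) {c : ℝ} (hc : c ≠ 0) :
    (1 + c • G).det = ∏ i, (1 + c * hG.eigenvalues i) := by
  have h1 : 1 + c • G = (-c) • (Matrix.scalar ι (-c⁻¹) - G) := by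
    rw [smul_sub, Matrix.scalar_apply, ← Matrix.smul_one_eq_diagonal, smul_smul]
    simp [hc]
  rw [h1, Matrix.det_smul, ← Matrix.eval_charpoly, hG.charpoly_eq, Polynomial.eval_prod,
    ← Finset.card_univ, ← Finset.prod_const, ← Finset.prod_mul_distrib]
  refine Finset.prod_congr rfl fun i _ => ?_
  simp only [Polynomial.eval_sub, Polynomial.eval_X, Polynomial.eval_C, RCLike.ofReal_real_eq_id,
    id_eq]
  field_simp
  ring

lemma log_det_nonneg {ι : Type*} [Fintype ι] [DecidableEq ι] {G : Matrix ι ι ℝ}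
    (hG : G.PosSemidef) {lam : ℝ} (hlam : 0 < lam) :
    0 ≤ Real.log (1 + (1 / lam) • G).det := by
  rw [det_one_add_smul_eq_prod hG.1 (by positivity)]
  refine Real.log_nonneg (Finset.one_le_prod fun i => ?_)
  have := hG.eigenvalues_nonneg i
  have : 0 ≤ 1 / lam * hG.1.eigenvalues i := by positivity
  simpa using this

/-- The function `u ↦ u log (1 + T / (u λ))`, the bound on the log-determinant of a kernel matrix
of rank `u` and trace at most `T`. -/
noncomputable def rankLog (lam T u : ℝ) : ℝ := u * Real.log (1 + T / (u * lam))

lemma rankLog_nonneg {lam T u : ℝ} (hlam : 0 < lam) (hT : 0 ≤ T) (hu : 0 ≤ u) :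
    0 ≤ rankLog lam T u :=
  mul_nonneg hu (Real.log_nonneg (by have : 0 ≤ T / (u * lam) := by positivity
                                     linarith))

lemma rankLog_mono_rank {lam T u u' : ℝ} (hlam : 0 < lam) (hT : 0 ≤ T) (hu : 0 ≤ u)
    (h : u ≤ u') : rankLog lam T u ≤ rankLog lam T u' := by
  rcases hu.eq_or_lt with rfl | hu0
  · simpa [rankLog] using rankLog_nonneg hlam hT h
  have hu' : 0 < u' := hu0.trans_le h
  have hy : 0 ≤ T / (u * lam) := by positivity
  -- Bernoulli's inequality with the exponent `u / u' ≤ 1`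
  have h1 := rpow_one_add_le_one_add_mul_self (s := T / (u * lam)) (by linarith)
    (p := u / u') (by positivity) ((div_le_one hu').2 h)
  have h2 := Real.log_le_log (by positivity) h1
  rw [Real.log_rpow (by positivity)] at h2
  have h3 : u / u' * (T / (u * lam)) = T / (u' * lam) := by field_simp
  rw [h3] at h2
  have h4 := mul_le_mul_of_nonneg_left h2 hu'.le
  have h5 : u' * (u / u' * Real.log (1 + T / (u * lam))) = rankLog lam T u := by
    rw [rankLog]; field_simp
  rw [h5] at h4
  exact h4

lemma rankLog_mono_trace {lam T T' u : ℝ} (hlam : 0 < lam) (hT : 0 ≤ T) (hu : 0 ≤ u)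
    (h : T ≤ T') : rankLog lam T u ≤ rankLog lam T' u := by
  unfold rankLog
  have : 0 ≤ T / (u * lam) := by positivity
  gcongr

lemma log_det_le_rankLog {ι : Type*} [Fintype ι] [DecidableEq ι] {G : Matrix ι ι ℝ}
    (hG : G.PosSemidef) {lam T : ℝ} (hlam : 0 < lam) (hT : G.trace ≤ T) :
    Real.log (1 + (1 / lam) • G).det ≤ rankLog lam T G.rank := by
  classical
  have htr : G.trace = ∑ i, hG.1.eigenvalues i := by simpa using hG.1.trace_eq_sum_eigenvalues
  have htr0 : 0 ≤ G.trace := htr ▸ Finset.sum_nonneg fun i _ => hG.eigenvalues_nonneg i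
  refine le_trans ?_ (rankLog_mono_trace hlam htr0 (Nat.cast_nonneg _) hT)
  set μ := hG.1.eigenvalues
  have hμ : ∀ i, 0 ≤ 1 / lam * μ i := fun i => by
    have := hG.eigenvalues_nonneg i
    positivity
  rw [det_one_add_smul_eq_prod hG.1 (by positivity), Real.log_prod fun i _ => by
    have := hμ i; exact (by linarith : (0 : ℝ) < 1 + 1 / lam * μ i).ne']
  have hrank : G.rank = (Finset.univ.filter fun i => μ i ≠ 0).card := by
    rw [hG.1.rank_eq_card_non_zero_eigs, Fintype.card_subtype]
  set S := Finset.univ.filter fun i => μ i ≠ 0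
  have h1 : ∑ i, Real.log (1 + 1 / lam * μ i) = ∑ i ∈ S, Real.log (1 + 1 / lam * μ i) := by
    refine (Finset.sum_subset (Finset.subset_univ S) fun i _ hi => ?_).symm
    have : μ i = 0 := by simpa [S] using hi
    simp [this]
  have h2 : G.trace = ∑ i ∈ S, μ i := by
    rw [htr]
    refine (Finset.sum_subset (Finset.subset_univ S) fun i _ hi => ?_).symm
    simpa [S] using hi
  rw [h1, rankLog, hrank]
  rcases Nat.eq_zero_or_pos S.card with h0 | h0
  · rw [Finset.card_eq_zero.1 h0]; simp
  have hc : (0 : ℝ) < S.card := by exact_mod_cast h0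
  set m : ℝ := G.trace / (S.card * lam)
  have hm : 0 ≤ m := by positivity
  -- Concavity of the logarithm in the form of its tangent at the mean `1 + m`.
  calc ∑ i ∈ S, Real.log (1 + 1 / lam * μ i)
      ≤ ∑ i ∈ S, (Real.log (1 + m) + (1 / lam * μ i - m) / (1 + m)) := by
        refine Finset.sum_le_sum fun i _ => ?_
        have hi := hμ i
        have h3 := Real.log_le_sub_one_of_pos
          (show 0 < (1 + 1 / lam * μ i) / (1 + m) by positivity)
        rw [Real.log_div (by positivity) (by positivity)] at h3
        have h4 : (1 + 1 / lam * μ i) / (1 + m) - 1 = (1 / lam * μ i - m) / (1 + m) := by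
          field_simp; ring
        linarith
    _ = S.card * Real.log (1 + m) := by
        rw [Finset.sum_add_distrib, ← Finset.sum_div, Finset.sum_sub_distrib, ← Finset.mul_sum,
          ← h2]
        simp only [Finset.sum_const, nsmul_eq_mul]
        have : 1 / lam * G.trace - S.card * m = 0 := by
          simp only [m]; field_simp; ring
        rw [this]; simp

lemma trace_gram_le {ι : Type*} [Fintype ι] (w : ι → H) (hw : ∀ i, ‖w i‖ ≤ 1) :
    (Matrix.gram ℝ w).trace ≤ Fintype.card ι := by
  rw [Matrix.trace, ← Finset.card_univ, Finset.cast_card]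
  refine Finset.sum_le_sum fun i _ => ?_
  rw [Matrix.diag_apply, Matrix.gram_apply, real_inner_self_eq_norm_sq]
  exact pow_le_one₀ (norm_nonneg _) (hw i)

/-- The sum of the squared confidence widths, bounded through the rank of the kernel matrix. -/
lemma sum_inner_covInv_le_rankLog {lam : ℝ} (hlam : 1 ≤ lam) (v : ℕ → H) (n : ℕ)
    (hv : ∀ i < n, ‖v i‖ ≤ 1) :
    ∑ i ∈ Finset.range n, ⟪v i, covInv lam v i (v i)⟫ ≤
      2 * rankLog lam n (Matrix.gram ℝ (fun i : Fin n => v i)).rank := by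
  refine (sum_inner_covInv_le hlam v n hv).trans ?_
  gcongr
  refine log_det_le_rankLog (Matrix.posSemidef_gram ℝ _) (by linarith) ?_
  simpa using trace_gram_le (fun i : Fin n => v i) fun i => hv i i.2

end LogDet

end RobustBandit

/-! ### Sub-Gaussian noise and the self-normalized bound -/

namespace RobustBandit

section SubGaussian

/-- The Gaussian mixture of the exponentials `exp (ξ η - ξ² / 2)` over `ξ ∼ N(m, v)`. -/
lemma lintegral_gaussian_mixture (m η : ℝ) {v : ℝ} (hv : 0 ≤ v) :
    ∫⁻ g, ENNReal.ofReal (Real.exp ((m + √v * g) * η - (m + √v * g) ^ 2 / 2))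
        ∂(ProbabilityTheory.gaussianReal 0 1) =
      ENNReal.ofReal
        (Real.exp ((2 * m * η + v * η ^ 2 - m ^ 2) / (2 * (1 + v))) / √(1 + v)) := by
  have hs : √v ^ 2 = v := Real.sq_sqrt hv
  set s := √v
  rw [ProbabilityTheory.gaussianReal_of_var_ne_zero _ one_ne_zero,
    lintegral_withDensity_eq_lintegral_mul _ (ProbabilityTheory.measurable_gaussianPDF 0 1)
      (by fun_prop)]
  set c := s * (η - m) / (1 + v)
  set C := Real.exp ((2 * m * η + v * η ^ 2 - m ^ 2) / (2 * (1 + v)))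
  have h1 : ∀ g, (ProbabilityTheory.gaussianPDF 0 1 *
      fun g => ENNReal.ofReal (Real.exp ((m + s * g) * η - (m + s * g) ^ 2 / 2))) g =
      ENNReal.ofReal ((√(2 * Real.pi))⁻¹ * C) *
        ENNReal.ofReal (Real.exp (-((1 + v) / 2) * (g - c) ^ 2)) := by
    intro g
    simp only [Pi.mul_apply, ProbabilityTheory.gaussianPDF, ProbabilityTheory.gaussianPDFReal]
    rw [← ENNReal.ofReal_mul (by positivity), ← ENNReal.ofReal_mul (by positivity)]
    congr 1
    simp only [NNReal.coe_one, mul_one, sub_zero]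
    rw [mul_assoc, mul_assoc, ← Real.exp_add, ← Real.exp_add]
    congr 2
    have : (1 + v) ≠ 0 := by positivity
    simp only [c]
    field_simp
    rw [← hs]
    ring
  simp_rw [h1]
  rw [lintegral_const_mul _ (by fun_prop),
    lintegral_sub_right_eq_self (fun g => ENNReal.ofReal (Real.exp (-((1 + v) / 2) * g ^ 2))) c,
    ← ofReal_integral_eq_lintegral_ofReal
      (integrable_exp_neg_mul_sq (by positivity)) (ae_of_all _ fun _ => (Real.exp_pos _).le),
    integral_gaussian, ← ENNReal.ofReal_mul (by positivity)]
  congr 1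
  have h2 : √(Real.pi / ((1 + v) / 2)) = √(2 * Real.pi) / √(1 + v) := by
    rw [← Real.sqrt_div (by positivity)]; congr 1; field_simp
  rw [h2]
  have : √(2 * Real.pi) ≠ 0 := by positivity
  field_simp

variable {Ω : Type*} {m mΩ : MeasurableSpace Ω} {μ : Measure Ω} {b : ℝ} {N : Ω → ℝ}

/-- A bound on a conditional expectation may be integrated against a nonnegative weight that is
measurable with respect to the conditioning σ-algebra. -/
lemma lintegral_mul_le_of_condExp_le [IsFiniteMeasure μ] (hm : m ≤ mΩ)
    {X : Ω → ℝ} (hX : Integrable X μ) (hX0 : ∀ ω, 0 ≤ X ω) {c : ℝ} (hc : 0 ≤ c)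
    (h : μ[X | m] ≤ᵐ[μ] fun _ => c) {W : Ω → ENNReal} (hW : Measurable[m] W) :
    ∫⁻ ω, W ω * ENNReal.ofReal (X ω) ∂μ ≤ ENNReal.ofReal c * ∫⁻ ω, W ω ∂μ := by
  have hXm : AEMeasurable (fun ω => ENNReal.ofReal (X ω)) μ := hX.aemeasurable.ennreal_ofReal
  set ν := μ.withDensity fun ω => ENNReal.ofReal (X ω)
  have hle : ν.trim hm ≤ ENNReal.ofReal c • μ.trim hm := by
    refine Measure.le_iff.2 fun A hA => ?_
    rw [Measure.smul_apply, trim_measurableSet_eq hm hA, trim_measurableSet_eq hm hA,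
      withDensity_apply _ (hm A hA),
      ← ofReal_integral_eq_lintegral_ofReal hX.integrableOn (ae_of_all _ hX0),
      ← setIntegral_condExp hm hX hA, smul_eq_mul, ← ofReal_measureReal,
      ← ENNReal.ofReal_mul hc]
    refine ENNReal.ofReal_le_ofReal ?_
    calc ∫ ω in A, (μ[X | m]) ω ∂μ ≤ ∫ _ in A, c ∂μ :=
          integral_mono_ae integrable_condExp.integrableOn (integrable_const c)
            (ae_restrict_of_ae h)
      _ = c * μ.real A := by simp [mul_comm]
  calc ∫⁻ ω, W ω * ENNReal.ofReal (X ω) ∂μ = ∫⁻ ω, W ω ∂ν := by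
        rw [lintegral_withDensity_eq_lintegral_mul₀ hXm (hW.mono hm le_rfl).aemeasurable]
        exact lintegral_congr fun ω => mul_comm _ _
    _ = ∫⁻ ω, W ω ∂(ν.trim hm) := (lintegral_trim hm hW).symm
    _ ≤ ∫⁻ ω, W ω ∂(ENNReal.ofReal c • μ.trim hm) := lintegral_mono' hle le_rfl
    _ = ENNReal.ofReal c * ∫⁻ ω, W ω ∂μ := by rw [lintegral_smul_measure, lintegral_trim hm hW,
        smul_eq_mul]

/-- A real random variable with conditionally `b`-sub-Gaussian law given the σ-algebra `m`. -/
structure IsCondSubGaussian {Ω : Type*} (m : MeasurableSpace Ω) {mΩ : MeasurableSpace Ω}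
    (μ : Measure Ω) (b : ℝ) (N : Ω → ℝ) : Prop where
  measurable : Measurable N
  integrable_exp : ∀ σ : ℝ, Integrable (fun ω => Real.exp (σ * N ω)) μ
  condExp_le : ∀ σ : ℝ, μ[fun ω => Real.exp (σ * N ω) | m] ≤ᵐ[μ]
    fun _ => Real.exp (σ ^ 2 * b ^ 2 / 2)

lemma IsCondSubGaussian.lintegral_le_const [IsFiniteMeasure μ] (hN : IsCondSubGaussian m μ b N)
    (hm : m ≤ mΩ) (σ : ℝ) {W : Ω → ENNReal} (hW : Measurable[m] W) :
    ∫⁻ ω, W ω * ENNReal.ofReal (Real.exp (σ * N ω - σ ^ 2 * b ^ 2 / 2)) ∂μ ≤ ∫⁻ ω, W ω ∂μ := by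
  have hc : 0 < Real.exp (σ ^ 2 * b ^ 2 / 2) := Real.exp_pos _
  have h := lintegral_mul_le_of_condExp_le hm (hN.integrable_exp σ)
    (fun ω => (Real.exp_pos _).le) hc.le (hN.condExp_le σ) hW
  have h1 : ∀ ω, W ω * ENNReal.ofReal (Real.exp (σ * N ω - σ ^ 2 * b ^ 2 / 2)) =
      (ENNReal.ofReal (Real.exp (σ ^ 2 * b ^ 2 / 2)))⁻¹ *
        (W ω * ENNReal.ofReal (Real.exp (σ * N ω))) := by
    intro ω
    rw [sub_eq_add_neg, Real.exp_add, Real.exp_neg, ENNReal.ofReal_mul (Real.exp_pos _).le,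
      ENNReal.ofReal_inv_of_pos hc]
    ring
  simp_rw [h1]
  rw [lintegral_const_mul' _ _ (by simp [hc])]
  calc _ ≤ (ENNReal.ofReal (Real.exp (σ ^ 2 * b ^ 2 / 2)))⁻¹ *
        (ENNReal.ofReal (Real.exp (σ ^ 2 * b ^ 2 / 2)) * ∫⁻ ω, W ω ∂μ) := by gcongr
    _ = ∫⁻ ω, W ω ∂μ := by
        rw [← mul_assoc, ENNReal.inv_mul_cancel (by simp [hc]) ENNReal.ofReal_ne_top, one_mul]

lemma exists_finite_range_approx {Ω : Type*} {m : MeasurableSpace Ω} {u : Ω → ℝ} (hu : Measurable u) :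
    ∃ (a : ℕ → Ω → ℝ) (S : ℕ → Finset ℝ), (∀ k ω, a k ω ∈ S k) ∧ (∀ k, Measurable (a k)) ∧
      ∀ ω, Tendsto (fun k => a k ω) atTop (nhds (u ω)) :=
  ⟨fun k => hu.stronglyMeasurable.approx k, fun k => (hu.stronglyMeasurable.approx k).range,
    fun k ω => (hu.stronglyMeasurable.approx k).mem_range_self ω,
    fun k => (hu.stronglyMeasurable.approx k).measurable, hu.stronglyMeasurable.tendsto_approx⟩

/-- The exponent in the sub-Gaussian inequality may be random, as long as it is measurable with
respect to the conditioning σ-algebra: approximate it by simple functions and use Fatou's lemma. -/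
lemma IsCondSubGaussian.lintegral_le [IsFiniteMeasure μ] (hN : IsCondSubGaussian m μ b N)
    (hm : m ≤ mΩ) {u : Ω → ℝ} (hu : Measurable[m] u) {W : Ω → ENNReal} (hW : Measurable[m] W) :
    ∫⁻ ω, W ω * ENNReal.ofReal (Real.exp (u ω * N ω - u ω ^ 2 * b ^ 2 / 2)) ∂μ ≤
      ∫⁻ ω, W ω ∂μ := by
  have hNm := hN.measurable
  have hWm : Measurable W := hW.mono hm le_rfl
  obtain ⟨a, S, hS, ha, hau⟩ := exists_finite_range_approx hu
  have ham : ∀ k, Measurable (a k) := fun k => (ha k).mono hm le_rfl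
  have hsimple : ∀ k, ∫⁻ ω, W ω *
      ENNReal.ofReal (Real.exp (a k ω * N ω - a k ω ^ 2 * b ^ 2 / 2)) ∂μ ≤ ∫⁻ ω, W ω ∂μ := by
    intro k
    have hfib : ∀ σ, MeasurableSet[m] (a k ⁻¹' {σ}) := fun σ =>
      ha k (measurableSet_singleton σ)
    have hsplit : ∀ F : ℝ → Ω → ENNReal, ∀ ω, W ω * F (a k ω) ω =
        ∑ σ ∈ S k, (a k ⁻¹' {σ}).indicator W ω * F σ ω := by
      intro F ω
      rw [Finset.sum_eq_single (a k ω)]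
      · rw [Set.indicator_of_mem (by simp)]
      · intro σ _ hσ
        rw [Set.indicator_of_notMem (by simpa using Ne.symm hσ), zero_mul]
      · intro h
        exact absurd (hS k ω) h
    rw [lintegral_congr fun ω => hsplit
      (fun σ ω => ENNReal.ofReal (Real.exp (σ * N ω - σ ^ 2 * b ^ 2 / 2))) ω]
    have h1 : ∫⁻ ω, W ω ∂μ = ∑ σ ∈ S k, ∫⁻ ω, (a k ⁻¹' {σ}).indicator W ω ∂μ := by
      rw [← lintegral_finsetSum _ fun σ _ => hWm.indicator (hm _ (hfib σ))]
      refine lintegral_congr fun ω => ?_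
      simpa using hsplit (fun _ _ => 1) ω
    rw [lintegral_finsetSum _ fun σ _ => by
      exact (hWm.indicator (hm _ (hfib σ))).mul (by fun_prop), h1]
    exact Finset.sum_le_sum fun σ _ => hN.lintegral_le_const hm σ (hW.indicator (hfib σ))
  have hlim : ∀ ω, Tendsto (fun k => W ω *
      ENNReal.ofReal (Real.exp (a k ω * N ω - a k ω ^ 2 * b ^ 2 / 2))) atTop
      (nhds (W ω * ENNReal.ofReal (Real.exp (u ω * N ω - u ω ^ 2 * b ^ 2 / 2)))) := by
    intro ω
    have h2 : Continuous fun σ : ℝ =>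
        ENNReal.ofReal (Real.exp (σ * N ω - σ ^ 2 * b ^ 2 / 2)) :=
      ENNReal.continuous_ofReal.comp (by fun_prop)
    exact ENNReal.Tendsto.const_mul ((h2.tendsto _).comp (hau ω)) (Or.inl (by simp [Real.exp_pos]))
  calc _ = ∫⁻ ω, liminf (fun k => W ω *
        ENNReal.ofReal (Real.exp (a k ω * N ω - a k ω ^ 2 * b ^ 2 / 2))) atTop ∂μ :=
        lintegral_congr fun ω => (hlim ω).liminf_eq.symm
    _ ≤ liminf (fun k => ∫⁻ ω, W ω *
        ENNReal.ofReal (Real.exp (a k ω * N ω - a k ω ^ 2 * b ^ 2 / 2)) ∂μ) atTop :=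
        lintegral_liminf_le fun k => hWm.mul (by fun_prop)
    _ ≤ ∫⁻ ω, W ω ∂μ := by
        refine (liminf_le_liminf (Eventually.of_forall hsimple)).trans ?_
        simp

/-- The one-step bound of the method of mixtures, with a one-dimensional Gaussian prior whose mean
and variance are known before the noise. -/
lemma IsCondSubGaussian.lintegral_mixture_le [IsFiniteMeasure μ] (hN : IsCondSubGaussian m μ b N)
    (hm : m ≤ mΩ) (hb : 0 < b) {e v : Ω → ℝ} (he : Measurable[m] e) (hv : Measurable[m] v)
    (hv0 : ∀ ω, 0 ≤ v ω) {W : Ω → ENNReal} (hW : Measurable[m] W) :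
    ∫⁻ ω, W ω * ENNReal.ofReal (Real.exp ((2 * e ω * (N ω / b) + v ω * (N ω / b) ^ 2 - e ω ^ 2) /
      (2 * (1 + v ω))) / √(1 + v ω)) ∂μ ≤ ∫⁻ ω, W ω ∂μ := by
  have hNm := hN.measurable
  have hWm : Measurable W := hW.mono hm le_rfl
  have hem : Measurable e := he.mono hm le_rfl
  have hvm : Measurable v := hv.mono hm le_rfl
  set γ := ProbabilityTheory.gaussianReal 0 1
  calc _ = ∫⁻ ω, ∫⁻ g, W ω * ENNReal.ofReal (Real.exp ((e ω + √(v ω) * g) * (N ω / b) -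
        (e ω + √(v ω) * g) ^ 2 / 2)) ∂γ ∂μ := by
        refine lintegral_congr fun ω => ?_
        rw [lintegral_const_mul _ (by fun_prop), lintegral_gaussian_mixture _ _ (hv0 ω)]
    _ = ∫⁻ g, ∫⁻ ω, W ω * ENNReal.ofReal (Real.exp ((e ω + √(v ω) * g) * (N ω / b) -
        (e ω + √(v ω) * g) ^ 2 / 2)) ∂μ ∂γ := by
        refine lintegral_lintegral_swap (Measurable.aemeasurable ?_)
        unfold Function.uncurry
        fun_prop
    _ ≤ ∫⁻ _, ∫⁻ ω, W ω ∂μ ∂γ := by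
        refine lintegral_mono fun g => ?_
        refine le_trans (le_of_eq (lintegral_congr fun ω => ?_))
          (hN.lintegral_le hm (u := fun ω => (e ω + √(v ω) * g) / b) ?_ hW)
        · congr 3
          field_simp
        · exact (he.add (hv.sqrt.mul_const g)).div_const b
    _ = ∫⁻ ω, W ω ∂μ := by simp [γ]

lemma IsCondSubGaussian.ae_eq_zero [IsProbabilityMeasure μ] (hN : IsCondSubGaussian m μ 0 N)
    (hm : m ≤ mΩ) : ∀ᵐ ω ∂μ, N ω = 0 := by
  have h1 : ∀ σ, ∫ ω, Real.exp (σ * N ω) ∂μ ≤ 1 := by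
    intro σ
    rw [← integral_condExp hm]
    calc _ ≤ ∫ _, (1 : ℝ) ∂μ := integral_mono_ae integrable_condExp (integrable_const _) (by
          have := hN.condExp_le σ
          simpa using this)
      _ = 1 := by simp
  have hi := ((hN.integrable_exp 1).add (hN.integrable_exp (-1))).sub (integrable_const 2)
  have h0 : ∀ ω, Real.exp (1 * N ω) + Real.exp (-1 * N ω) - 2 =
      Real.exp (-N ω) * (Real.exp (N ω) - 1) ^ 2 := by
    intro ω
    have : Real.exp (-N ω) * Real.exp (N ω) = 1 := by rw [← Real.exp_add]; simp
    rw [one_mul, neg_one_mul]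
    linear_combination (-Real.exp (N ω) + 2) * this
  have h2 : ∫ ω, (Real.exp (1 * N ω) + Real.exp (-1 * N ω) - 2) ∂μ = 0 := by
    refine le_antisymm ?_ (integral_nonneg fun ω => ?_)
    · have h3 := integral_sub ((hN.integrable_exp 1).add (hN.integrable_exp (-1)))
        (integrable_const (2 : ℝ))
      simp only [Pi.add_apply] at h3
      rw [h3, integral_add (hN.integrable_exp 1) (hN.integrable_exp (-1))]
      have := h1 1
      have := h1 (-1)
      simp only [integral_const, probReal_univ, smul_eq_mul, one_mul]
      simp only [one_mul] at *
      linarith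
    · simp only [Pi.zero_apply]
      rw [h0]; positivity
  have h3 := (integral_eq_zero_iff_of_nonneg (fun ω => by
    change 0 ≤ Real.exp (1 * N ω) + Real.exp (-1 * N ω) - 2
    rw [h0]; positivity) hi).1 h2
  filter_upwards [h3] with ω hω
  have h4 : Real.exp (-N ω) * (Real.exp (N ω) - 1) ^ 2 = 0 := by
    rw [← h0]; simpa using hω
  have h5 : Real.exp (N ω) - 1 = 0 := by
    simpa [Real.exp_ne_zero] using h4
  exact (Real.exp_eq_one_iff _).1 (by linarith)

/-- Ville's maximal inequality for a nonnegative supermartingale with values in `[0, ∞]`. -/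
lemma measure_exists_ge_le [IsProbabilityMeasure μ] (ℱ : Filtration ℕ mΩ) {M : ℕ → Ω → ENNReal}
    (hM : ∀ n, Measurable[ℱ n] (M n)) (h0 : ∀ ω, M 0 ω = 1)
    (hstep : ∀ n, ∀ A, MeasurableSet[ℱ n] A → ∫⁻ ω in A, M (n + 1) ω ∂μ ≤ ∫⁻ ω in A, M n ω ∂μ)
    (c : ENNReal) : c * μ {ω | ∃ n, c ≤ M n ω} ≤ 1 := by
  set S : ℕ → Set Ω := fun n => {ω | ∀ k ≤ n, M k ω < c}
  have hSm : ∀ n, MeasurableSet[ℱ n] (S n) := by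
    intro n
    have : S n = ⋂ k ∈ Set.Iic n, M k ⁻¹' Set.Iio c := by ext; simp [S]
    rw [this]
    refine MeasurableSet.biInter (Set.to_countable _) fun k hk => ?_
    exact ℱ.mono hk _ (hM k measurableSet_Iio)
  have hSm' : ∀ n, MeasurableSet (S n) := fun n => ℱ.le n _ (hSm n)
  have hMm : ∀ n, Measurable (M n) := fun n => (hM n).mono (ℱ.le n) le_rfl
  -- The process stopped at the first passage of level `c` has expectation at most one.
  have key : ∀ n, c * μ (S n)ᶜ + ∫⁻ ω in S n, M n ω ∂μ ≤ 1 := by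
    intro n
    induction n with
    | zero =>
      calc _ ≤ ∫⁻ ω in (S 0)ᶜ, M 0 ω ∂μ + ∫⁻ ω in S 0, M 0 ω ∂μ := by
            gcongr
            rw [← setLIntegral_const]
            refine setLIntegral_mono (hMm 0) fun ω hω => ?_
            simpa [S] using hω
        _ = 1 := by
            rw [add_comm, lintegral_add_compl _ (hSm' 0)]
            simp [h0]
    | succ n ih =>
      have hsub : S (n + 1) ⊆ S n := fun ω hω k hk => hω k (by omega)
      have h1 : (S (n + 1))ᶜ = (S n)ᶜ ∪ (S n \ S (n + 1)) := by
        ext ω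
        have := @hsub ω
        simp only [Set.mem_compl_iff, Set.mem_union, Set.mem_sdiff]
        tauto
      have h2 : c * μ (S n \ S (n + 1)) ≤ ∫⁻ ω in S n \ S (n + 1), M (n + 1) ω ∂μ := by
        rw [← setLIntegral_const]
        refine setLIntegral_mono (hMm _) fun ω hω => ?_
        by_contra hlt
        refine hω.2 fun k hk => ?_
        rcases Nat.lt_or_ge n k with h | h
        · have : k = n + 1 := by omega
          subst this
          exact not_le.1 hlt
        · exact hω.1 k h
      calc c * μ (S (n + 1))ᶜ + ∫⁻ ω in S (n + 1), M (n + 1) ω ∂μ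
          ≤ (c * μ (S n)ᶜ + c * μ (S n \ S (n + 1))) + ∫⁻ ω in S (n + 1), M (n + 1) ω ∂μ := by
            rw [h1, ← mul_add]
            gcongr
            exact measure_union_le _ _
        _ ≤ (c * μ (S n)ᶜ + ∫⁻ ω in S n \ S (n + 1), M (n + 1) ω ∂μ) +
              ∫⁻ ω in S (n + 1), M (n + 1) ω ∂μ := by gcongr
        _ = c * μ (S n)ᶜ + ∫⁻ ω in S n, M (n + 1) ω ∂μ := by
            rw [add_assoc, add_comm (∫⁻ ω in S n \ S (n + 1), M (n + 1) ω ∂μ)]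
            congr 1
            have := lintegral_inter_add_sdiff (μ := μ) (M (n + 1)) (S n) (hSm' (n + 1))
            rwa [Set.inter_eq_right.2 hsub] at this
        _ ≤ c * μ (S n)ᶜ + ∫⁻ ω in S n, M n ω ∂μ := by
            exact add_le_add le_rfl (hstep n _ (hSm n))
        _ ≤ 1 := ih
  have hunion : {ω | ∃ n, c ≤ M n ω} = ⋃ n, (S n)ᶜ := by
    ext ω
    simp only [Set.mem_ofPred_eq, Set.mem_iUnion, Set.mem_compl_iff, S, not_forall, not_lt]
    exact ⟨fun ⟨n, hn⟩ => ⟨n, n, le_rfl, hn⟩, fun ⟨_, k, _, hk⟩ => ⟨k, hk⟩⟩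
  have hmono : Monotone fun n => (S n)ᶜ := by
    intro n n' hnn
    exact Set.compl_subset_compl.2 fun ω hω k hk => hω k (hk.trans hnn)
  rw [hunion, hmono.measure_iUnion, ENNReal.mul_iSup]
  exact iSup_le fun n => le_self_add.trans (key n)

end SubGaussian

section SelfNormalized

variable {H : Type*} [NormedAddCommGroup H] [InnerProductSpace ℝ H]
  {Ω : Type*} {mΩ : MeasurableSpace Ω} {μ : Measure Ω}

/-- The noise-weighted sum `∑ i < n, N i • v i`. -/
noncomputable def noiseSum (N : ℕ → ℝ) (v : ℕ → H) (n : ℕ) : H :=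
  ∑ i ∈ Finset.range n, N i • v i

lemma measurable_inner_covInv {m : MeasurableSpace Ω} (lam : ℝ) {v : ℕ → Ω → H} {k : ℕ}
    (hv : ∀ i ≤ k, ∀ j ≤ k, Measurable[m] fun ω => ⟪v i ω, v j ω⟫) {n : ℕ} (hn : n ≤ k + 1)
    {i j : ℕ} (hi : i ≤ k) (hj : j ≤ k) :
    Measurable[m] fun ω => ⟪v i ω, covInv lam (fun l => v l ω) n (v j ω)⟫ := by
  induction n generalizing i j with
  | zero =>
    simp only [covInv_zero, inner_smul_right]
    exact (hv i hi j hj).const_mul _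
  | succ n ih =>
    simp only [covInv_succ, inner_sub_right, inner_smul_right, covInv_symm]
    have hnk : n ≤ k := by omega
    exact (ih (by omega) hi hj).sub ((((measurable_const.add (ih (by omega) hnk hnk)).inv).mul
      (ih (by omega) hnk hj)).mul (ih (by omega) hi hnk))

lemma inner_covInv_noiseSum (lam : ℝ) (N : ℕ → ℝ) (v v' : ℕ → H) (n k : ℕ) (u : H) :
    ⟪u, covInv lam v' k (noiseSum N v n)⟫ =
      ∑ i ∈ Finset.range n, N i * ⟪u, covInv lam v' k (v i)⟫ := by
  simp [noiseSum, inner_sum, inner_smul_right]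

/-- The increment of the self-normalized quadratic form when a vector and its noise are added. -/
lemma inner_covInv_succ_noiseSum {lam : ℝ} (hlam : 0 < lam) (N : ℕ → ℝ) (v : ℕ → H) (n : ℕ) :
    ⟪noiseSum N v (n + 1), covInv lam v (n + 1) (noiseSum N v (n + 1))⟫ =
      ⟪noiseSum N v n, covInv lam v n (noiseSum N v n)⟫ +
        (2 * ⟪v n, covInv lam v n (noiseSum N v n)⟫ * N n +
          ⟪v n, covInv lam v n (v n)⟫ * N n ^ 2 -
          ⟪v n, covInv lam v n (noiseSum N v n)⟫ ^ 2) /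
        (1 + ⟪v n, covInv lam v n (v n)⟫) := by
  have hs := inner_covInv_self_nonneg hlam v n (v n)
  have h1 : noiseSum N v (n + 1) = noiseSum N v n + N n • v n := Finset.sum_range_succ _ _
  have hc : ⟪noiseSum N v n, covInv lam v n (v n)⟫ = ⟪v n, covInv lam v n (noiseSum N v n)⟫ := by
    rw [← covInv_symm, real_inner_comm]
  rw [h1, covInv_succ]
  simp only [map_add, map_smul, inner_add_left, inner_add_right, inner_sub_right, inner_smul_left,
    inner_smul_right, covInv_symm, RCLike.conj_to_real, hc]
  field_simp
  ring

/-- The supermartingale of the method of mixtures: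
`exp (‖S‖² / (2 b²)) / √det (1 + K / λ)` in terms of the rank-one updates. -/
noncomputable def mixture (lam b : ℝ) (N : ℕ → ℝ) (v : ℕ → H) (n : ℕ) : ℝ :=
  Real.exp (⟪noiseSum N v n, covInv lam v n (noiseSum N v n)⟫ / (2 * b ^ 2) -
    (∑ i ∈ Finset.range n, Real.log (1 + ⟪v i, covInv lam v i (v i)⟫)) / 2)

lemma mixture_succ {lam b : ℝ} (hlam : 0 < lam) (hb : 0 < b) (N : ℕ → ℝ) (v : ℕ → H) (n : ℕ) :
    mixture lam b N v (n + 1) = mixture lam b N v n *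
      (Real.exp ((2 * (⟪v n, covInv lam v n (noiseSum N v n)⟫ / b) * (N n / b) +
        ⟪v n, covInv lam v n (v n)⟫ * (N n / b) ^ 2 -
        (⟪v n, covInv lam v n (noiseSum N v n)⟫ / b) ^ 2) /
          (2 * (1 + ⟪v n, covInv lam v n (v n)⟫))) /
        √(1 + ⟪v n, covInv lam v n (v n)⟫)) := by
  have hs := inner_covInv_self_nonneg hlam v n (v n)
  rw [mixture, mixture, inner_covInv_succ_noiseSum hlam, Finset.sum_range_succ]
  set s := ⟪v n, covInv lam v n (v n)⟫
  have h1 : √(1 + s) = Real.exp (Real.log (1 + s) / 2) := by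
    rw [Real.sqrt_eq_rpow, Real.rpow_def_of_pos (by linarith)]
    ring_nf
  rw [h1, ← Real.exp_sub, ← Real.exp_add]
  congr 1
  field_simp
  ring

/-- The self-normalized tail bound, uniform in time: with probability at least `1 - δ`, for all `n`
the noise-weighted sum satisfies `‖S‖²_{V⁻¹} ≤ b² (log det (1 + K / λ) - 2 log δ)`. -/
theorem measure_selfNormalized_ge [IsProbabilityMeasure μ] (ℱ : Filtration ℕ mΩ) {lam b δ : ℝ}
    (hlam : 0 < lam) (hb : 0 ≤ b) (hδ0 : 0 < δ) {v : ℕ → Ω → H} {N : ℕ → Ω → ℝ}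
    (hv : ∀ k, ∀ i ≤ k, ∀ j ≤ k, Measurable[ℱ k] fun ω => ⟪v i ω, v j ω⟫)
    (hNm : ∀ k, Measurable[ℱ (k + 1)] (N k))
    (hN : ∀ k, IsCondSubGaussian (ℱ k) μ b (N k)) :
    MeasurableSet {ω | ∀ n, ⟪noiseSum (N · ω) (v · ω) n,
        covInv lam (v · ω) n (noiseSum (N · ω) (v · ω) n)⟫ ≤
      b ^ 2 * (∑ i ∈ Finset.range n,
        Real.log (1 + ⟪v i ω, covInv lam (v · ω) i (v i ω)⟫) - 2 * Real.log δ)} ∧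
    ENNReal.ofReal (1 - δ) ≤ μ {ω | ∀ n, ⟪noiseSum (N · ω) (v · ω) n,
        covInv lam (v · ω) n (noiseSum (N · ω) (v · ω) n)⟫ ≤
      b ^ 2 * (∑ i ∈ Finset.range n,
        Real.log (1 + ⟪v i ω, covInv lam (v · ω) i (v i ω)⟫) - 2 * Real.log δ)} := by
  have hQ : ∀ k n, n ≤ k + 1 → ∀ i ≤ k, (∀ l < n, Measurable[ℱ k] (N l)) →
      Measurable[ℱ k] fun ω => ⟪v i ω, covInv lam (v · ω) n (noiseSum (N · ω) (v · ω) n)⟫ := by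
    intro k n hn i hi hNl
    simp only [inner_covInv_noiseSum]
    refine Finset.measurable_fun_sum _ fun l hl => ?_
    rw [Finset.mem_range] at hl
    exact (hNl l hl).mul (measurable_inner_covInv lam (hv k) hn hi (by omega))
  have hQQ : ∀ n, Measurable[ℱ n] fun ω => ⟪noiseSum (N · ω) (v · ω) n,
      covInv lam (v · ω) n (noiseSum (N · ω) (v · ω) n)⟫ := by
    intro n
    have h1 : ∀ ω, ⟪noiseSum (N · ω) (v · ω) n,
        covInv lam (v · ω) n (noiseSum (N · ω) (v · ω) n)⟫ = ∑ l ∈ Finset.range n,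
          N l ω * ⟪v l ω, covInv lam (v · ω) n (noiseSum (N · ω) (v · ω) n)⟫ := by
      intro ω
      conv_lhs => rw [noiseSum, sum_inner]
      simp [inner_smul_left, noiseSum]
    simp only [h1]
    refine Finset.measurable_fun_sum _ fun l hl => ?_
    rw [Finset.mem_range] at hl
    have hNl : ∀ l < n, Measurable[ℱ n] (N l) := fun l hl =>
      (hNm l).mono (ℱ.mono (by omega)) le_rfl
    exact (hNl l hl).mul (hQ n n (by omega) l hl.le hNl)
  have hs : ∀ k i, i ≤ k →
      Measurable[ℱ k] fun ω => ⟪v i ω, covInv lam (v · ω) i (v i ω)⟫ := fun k i hi =>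
    measurable_inner_covInv lam (hv k) (by omega) hi hi
  have hL : ∀ n, Measurable[ℱ n] fun ω => ∑ i ∈ Finset.range n,
      Real.log (1 + ⟪v i ω, covInv lam (v · ω) i (v i ω)⟫) := by
    intro n
    refine Finset.measurable_fun_sum _ fun l hl => ?_
    rw [Finset.mem_range] at hl
    exact (measurable_const.add (hs n l hl.le)).log
  refine ⟨?_, ?_⟩
  · rw [Set.ofPred_forall]
    refine MeasurableSet.iInter fun n => measurableSet_le ((hQQ n).mono (ℱ.le n) le_rfl) ?_
    exact (((hL n).mono (ℱ.le n) le_rfl).sub_const _).const_mul _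
  rcases hb.eq_or_lt with rfl | hb
  · -- Without noise the weighted sum vanishes almost surely.
    have hz : ∀ᵐ ω ∂μ, ∀ k, N k ω = 0 := ae_all_iff.2 fun k => (hN k).ae_eq_zero (ℱ.le k)
    calc ENNReal.ofReal (1 - δ) ≤ 1 := ENNReal.ofReal_le_one.2 (by linarith)
      _ = μ Set.univ := measure_univ.symm
      _ ≤ _ := measure_mono_ae (by
        filter_upwards [hz] with ω hω _ n
        simp [noiseSum, hω])
  set M : ℕ → Ω → ENNReal := fun n ω => ENNReal.ofReal (mixture lam b (N · ω) (v · ω) n)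
  have hM : ∀ n, Measurable[ℱ n] (M n) := fun n =>
    (((hQQ n).div_const _).sub ((hL n).div_const 2)).exp.ennreal_ofReal
  have hville := measure_exists_ge_le (μ := μ) ℱ hM (fun ω => by simp [M, mixture, noiseSum])
    (fun n A hA => by
      change MeasurableSet[ℱ n] A at hA
      have h1 := (hN n).lintegral_mixture_le (ℱ.le n) hb
        (e := fun ω => ⟪v n ω, covInv lam (v · ω) n (noiseSum (N · ω) (v · ω) n)⟫ / b)
        (v := fun ω => ⟪v n ω, covInv lam (v · ω) n (v n ω)⟫)
        ((hQ n n (by omega) n le_rfl fun l hl =>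
          (hNm l).mono (ℱ.mono (by omega)) le_rfl).div_const b) (hs n n le_rfl)
        (fun ω => inner_covInv_self_nonneg hlam _ _ _) ((hM n).indicator hA)
      rw [← lintegral_indicator (ℱ.le n _ hA), ← lintegral_indicator (ℱ.le n _ hA)]
      refine le_trans (le_of_eq (lintegral_congr fun ω => ?_)) h1
      by_cases hω : ω ∈ A
      · rw [Set.indicator_of_mem hω, Set.indicator_of_mem hω]
        simp only [M]
        rw [mixture_succ hlam hb, ENNReal.ofReal_mul (by unfold mixture; positivity)]
      · rw [Set.indicator_of_notMem hω, Set.indicator_of_notMem hω, zero_mul])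
    (ENNReal.ofReal δ⁻¹)
  set E := {ω | ∀ n, ⟪noiseSum (N · ω) (v · ω) n,
        covInv lam (v · ω) n (noiseSum (N · ω) (v · ω) n)⟫ ≤
      b ^ 2 * (∑ i ∈ Finset.range n,
        Real.log (1 + ⟪v i ω, covInv lam (v · ω) i (v i ω)⟫) - 2 * Real.log δ)}
  have hsub : Eᶜ ⊆ {ω | ∃ n, ENNReal.ofReal δ⁻¹ ≤ M n ω} := by
    intro ω hω
    simp only [E, Set.mem_compl_iff, Set.mem_ofPred_eq, not_forall, not_le] at hω
    obtain ⟨n, hn⟩ := hω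
    refine ⟨n, ENNReal.ofReal_le_ofReal ?_⟩
    rw [mixture, ← Real.exp_log (inv_pos.2 hδ0), Real.log_inv]
    refine Real.exp_le_exp.2 ?_
    rw [← lt_div_iff₀' (by positivity)] at hn
    have : ∀ x : ℝ, x / (2 * b ^ 2) = x / b ^ 2 / 2 := fun x => by field_simp
    rw [this]
    linarith
  have hcompl : μ Eᶜ ≤ ENNReal.ofReal δ := by
    have h2 : ENNReal.ofReal δ⁻¹ * μ Eᶜ ≤ 1 := le_trans (by gcongr) hville
    rw [ENNReal.ofReal_inv_of_pos hδ0] at h2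
    have h3 := mul_le_mul_right h2 (ENNReal.ofReal δ)
    rwa [← mul_assoc, ENNReal.mul_inv_cancel (by simpa using hδ0) ENNReal.ofReal_ne_top, one_mul,
      mul_one] at h3
  have h4 : 1 ≤ μ E + ENNReal.ofReal δ := by
    calc (1 : ENNReal) = μ Set.univ := measure_univ.symm
      _ ≤ μ E + μ Eᶜ := by rw [← Set.union_compl_self E]; exact measure_union_le _ _
      _ ≤ _ := by gcongr
  rw [ENNReal.ofReal_sub _ hδ0.le, ENNReal.ofReal_one]
  exact tsub_le_iff_right.2 h4

end SelfNormalized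

end RobustBandit

/-! ### Confidence bounds and the regret of one round -/

namespace RobustBandit

namespace Problem

variable {p r : ℕ} {H : Type*} [NormedAddCommGroup H] [InnerProductSpace ℝ H]
  (P : Problem p r H) (R : Run p r)

/-- The feature vectors of the true context–arm vectors; round `i + 1` has index `i`. -/
def vec (i : ℕ) : H := P.feat (R.z (i + 1))

/-- The enumeration of the rounds `1, …, t - 1`. -/
def roundEquiv (t : ℕ) : Fin (t - 1) ≃ Finset.Ico 1 t where
  toFun i := ⟨i + 1, Finset.mem_Ico.2 ⟨by omega, by omega⟩⟩
  invFun j := ⟨j - 1, by have := Finset.mem_Ico.1 j.2; omega⟩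
  left_inv i := by simp
  right_inv j := by
    have := Finset.mem_Ico.1 j.2
    ext
    simp only
    omega

lemma K_submatrix (t : ℕ) :
    (P.K R t).submatrix (roundEquiv t) (roundEquiv t) =
      Matrix.gram ℝ fun i : Fin (t - 1) => P.vec R i := rfl

lemma cov_vec (t : ℕ) (u : H) :
    cov P.lam (Finset.range (t - 1)) (P.vec R) u =
      cov P.lam Finset.univ (fun i : Finset.Ico 1 t => P.feat (R.z i)) u := by
  rw [cov_fin, cov, cov]
  congr 1
  exact Fintype.sum_equiv (roundEquiv t) _ _ fun i => rfl

lemma gamma_eq (hlam : 0 < P.lam) (t : ℕ) :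
    P.gamma R t = ∑ i ∈ Finset.range (t - 1),
      Real.log (1 + ⟪P.vec R i, covInv P.lam (P.vec R) i (P.vec R i)⟫) := by
  rw [← log_det_one_add_gram hlam, gamma, ← Matrix.det_submatrix_equiv_self (roundEquiv t),
    ← K_submatrix]
  congr 2
  ext i j
  simp [Matrix.one_apply]

lemma dbar_eq (T : ℕ) : P.dbar R T = (Matrix.gram ℝ fun i : Fin T => P.vec R i).rank :=
  (Matrix.rank_submatrix (P.K R (T + 1)) (roundEquiv (T + 1)) (roundEquiv (T + 1))).symm

lemma width_eq (hlam : 0 < P.lam) (t : ℕ) (x : Vec p) (a : Vec r) :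
    P.width R t x a = covNorm P.lam (P.vec R) (t - 1) (P.feat (concat x a)) := by
  rw [covNorm, ← inner_covInv_eq hlam _ _ _ (P.cov_vec R t)]
  rfl

lemma fhat_eq (hlam : 0 < P.lam) (t : ℕ) (x : Vec p) (a : Vec r) :
    P.fhat R t x a = ⟪P.feat (concat x a), covInv P.lam (P.vec R) (t - 1)
      (∑ i : Finset.Ico 1 t, P.y R i • P.feat (R.z i))⟫ :=
  inner_covInv_sum hlam _ _ _ (P.cov_vec R t) _ _

lemma sum_y_smul (t : ℕ) :
    ∑ i : Finset.Ico 1 t, P.y R i • P.feat (R.z i) =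
      cov P.lam (Finset.range (t - 1)) (P.vec R) P.theta - P.lam • P.theta +
        noiseSum (fun i => R.noise (i + 1)) (P.vec R) (t - 1) := by
  rw [cov, add_sub_cancel_left, noiseSum, ← Finset.sum_add_distrib, Finset.sum_range]
  refine (Fintype.sum_equiv (roundEquiv t) _ _ fun i => ?_).symm
  rw [← add_smul]
  rfl

/-- On a run, the self-normalized noise bound holds in every round. -/
def NoiseBound : Prop :=
  ∀ n, ⟪noiseSum (fun i => R.noise (i + 1)) (P.vec R) n,
      covInv P.lam (P.vec R) n (noiseSum (fun i => R.noise (i + 1)) (P.vec R) n)⟫ ≤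
    P.b ^ 2 * (∑ i ∈ Finset.range n,
      Real.log (1 + ⟪P.vec R i, covInv P.lam (P.vec R) i (P.vec R i)⟫) - 2 * Real.log P.delta)

variable {P R}

/-- The confidence bound: the estimation error is `⟪φ, V⁻¹ (λ θ - S)⟫` with `S` the noise-weighted
sum, and both `λ θ` and `S` are controlled in the inverse covariance norm. -/
lemma abs_f_sub_fhat_le (hlam : 0 < P.lam) (hb : 0 ≤ P.b) (hB : ‖P.theta‖ ≤ P.B)
    (hE : P.NoiseBound R) (t : ℕ) (x : Vec p) (a : Vec r) :
    |P.f x a - P.fhat R t x a| ≤ P.h R t * P.width R t x a := by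
  set S := noiseSum (fun i => R.noise (i + 1)) (P.vec R) (t - 1)
  have h1 : P.f x a - P.fhat R t x a = ⟪P.feat (concat x a),
      covInv P.lam (P.vec R) (t - 1) (P.lam • P.theta + (-1 : ℝ) • S)⟫ := by
    rw [fhat_eq P R hlam, sum_y_smul, map_add, map_sub, covInv_cov hlam, map_add, map_smul _ (-1),
      f, inner_add_right, inner_sub_right, inner_add_right, inner_smul_right]
    ring
  rw [h1, P.width_eq R hlam, mul_comm]
  refine (abs_inner_covInv_le hlam _ _ _ _).trans ?_
  gcongr
  · exact covNorm_nonneg ..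
  refine (covNorm_add_le hlam _ _ _ _).trans ?_
  rw [h]
  refine add_le_add ?_ ?_
  · calc _ ≤ (√P.lam)⁻¹ * ‖P.lam • P.theta‖ := covNorm_le hlam _ _ _
      _ = √P.lam * ‖P.theta‖ := by
        rw [norm_smul, Real.norm_of_nonneg hlam.le]
        nth_rewrite 2 [← Real.mul_self_sqrt hlam.le]
        have : √P.lam ≠ 0 := by positivity
        field_simp
      _ ≤ _ := by gcongr
  · have h2 := hE (t - 1)
    rw [← P.gamma_eq R hlam] at h2
    rw [covNorm, map_smul, inner_smul_left, inner_smul_right]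
    calc _ ≤ √(P.b ^ 2 * (P.gamma R t - 2 * Real.log P.delta)) :=
          Real.sqrt_le_sqrt (by simpa using h2)
      _ = _ := by rw [Real.sqrt_mul (sq_nonneg _), Real.sqrt_sq hb]

lemma h_nonneg (hb : 0 ≤ P.b) (hB : ‖P.theta‖ ≤ P.B) (t : ℕ) : 0 ≤ P.h R t := by
  have : 0 ≤ P.B := (norm_nonneg _).trans hB
  unfold h
  positivity

lemma h_mono (hlam : 0 < P.lam) (hb : 0 ≤ P.b) {s t : ℕ} (hst : s ≤ t) :
    P.h R s ≤ P.h R t := by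
  unfold h
  rw [P.gamma_eq R hlam, P.gamma_eq R hlam]
  gcongr
  intro i _ _
  exact Real.log_nonneg (by have := inner_covInv_self_nonneg hlam (P.vec R) i (P.vec R i)
                            linarith)

lemma width_nonneg (t : ℕ) (x : Vec p) (a : Vec r) : 0 ≤ P.width R t x a := Real.sqrt_nonneg _

lemma width_le (hlam : 0 < P.lam) (hfeat : ∀ z ∈ P.space, ‖P.feat z‖ ≤ 1) (t : ℕ) {x : Vec p}
    {a : Vec r} (hx : x ∈ P.ctx) (ha : a ∈ P.arms) : P.width R t x a ≤ (√P.lam)⁻¹ := by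
  rw [P.width_eq R hlam]
  refine (covNorm_le hlam _ _ _).trans (mul_le_of_le_one_right (by positivity) ?_)
  exact hfeat _ ⟨x, hx, a, ha, rfl⟩

lemma abs_f_le (hfeat : ∀ z ∈ P.space, ‖P.feat z‖ ≤ 1) {x : Vec p} {a : Vec r} (hx : x ∈ P.ctx)
    (ha : a ∈ P.arms) : |P.f x a| ≤ ‖P.theta‖ :=
  (abs_real_inner_le_norm _ _).trans
    (mul_le_of_le_one_left (norm_nonneg _) (hfeat _ ⟨x, hx, a, ha, rfl⟩))

lemma exists_abs_ucb_le (hlam : 0 < P.lam) (hb : 0 ≤ P.b) (hB : ‖P.theta‖ ≤ P.B)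
    (hfeat : ∀ z ∈ P.space, ‖P.feat z‖ ≤ 1) (t : ℕ) :
    ∃ c, ∀ x ∈ P.ctx, ∀ a ∈ P.arms, |P.ucb R t x a| ≤ c := by
  refine ⟨‖covInv P.lam (P.vec R) (t - 1) (∑ i : Finset.Ico 1 t, P.y R i • P.feat (R.z i))‖ +
    P.h R t * (√P.lam)⁻¹, fun x hx a ha => ?_⟩
  refine (abs_add_le _ _).trans (add_le_add ?_ ?_)
  · rw [P.fhat_eq R hlam]
    exact (abs_real_inner_le_norm _ _).trans
      (mul_le_of_le_one_left (norm_nonneg _) (hfeat _ ⟨x, hx, a, ha, rfl⟩))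
  · rw [abs_of_nonneg (mul_nonneg (h_nonneg hb hB t) (width_nonneg ..))]
    exact mul_le_mul_of_nonneg_left (width_le hlam hfeat t hx ha) (h_nonneg hb hB t)

/-- A bounded function on a set minus its value is bounded by twice the bound. -/
lemma iSup_sub_le_two_mul {α : Type*} {s : Set α} {F : α → ℝ} {c : ℝ} (hF : ∀ a ∈ s, |F a| ≤ c)
    {a : α} (ha : a ∈ s) : (⨆ a' : s, F a') - F a ≤ 2 * c := by
  have : Nonempty s := ⟨⟨a, ha⟩⟩
  have h1 : (⨆ a' : s, F a') ≤ c := ciSup_le fun a' => (le_abs_self _).trans (hF _ a'.2)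
  have h2 := neg_abs_le (F a)
  have h3 := hF a ha
  linarith

lemma bddAbove_range_of_abs_le {α : Type*} {s : Set α} {F : α → ℝ} {c : ℝ}
    (hF : ∀ a ∈ s, |F a| ≤ c) : BddAbove (Set.range fun a : s => F a) :=
  ⟨c, by rintro _ ⟨a, rfl⟩; exact (le_abs_self _).trans (hF _ a.2)⟩

/-- The regret of one round: the regret of the selected arm is bounded by its degradation, which is
at most that of the minimax arm, which is at most the optimal worst-case regret, up to the confidence
widths at the true and at the considered context–arm vector. -/
lemma regret_le (hlam : 0 < P.lam) (hb : 0 ≤ P.b) (hB : ‖P.theta‖ ≤ P.B)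
    (hfeat : ∀ z ∈ P.space, ‖P.feat z‖ ≤ 1) (hE : P.NoiseBound R)
    (htrue : ∀ t, 1 ≤ t → R.x t ∈ P.region R t) (halg : P.IsMinWD R) {xd : ℕ → Vec p}
    {ad : ℕ → Vec r} (hcons : P.IsConsidered R xd ad) {t : ℕ} (ht : 1 ≤ t) :
    P.regret (R.x t) (R.a t) ≤ P.MR R t +
      (2 * P.h R t * P.width R t (xd t) (ad t) + 2 * P.h R t * P.width R t (R.x t) (R.a t)) := by
  obtain ⟨⟨at_, hat, hmin, hxd, hmax⟩, had, hbest⟩ := hcons t ht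
  obtain ⟨hal, halmin⟩ := halg t ht
  have hx := htrue t ht
  obtain ⟨c, hc⟩ := exists_abs_ucb_le (R := R) hlam hb hB hfeat t
  have : Nonempty P.arms := ⟨⟨_, hal⟩⟩
  have : Nonempty (P.region R t) := ⟨⟨_, hx⟩⟩
  have hucb_lo : ∀ x a, P.f x a ≤ P.ucb R t x a := fun x a => by
    have := (abs_le.1 (abs_f_sub_fhat_le hlam hb hB hE t x a)).2
    unfold ucb; linarith
  have hucb_hi : ∀ x a, P.ucb R t x a ≤ P.f x a + 2 * P.h R t * P.width R t x a := fun x a => by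
    have := (abs_le.1 (abs_f_sub_fhat_le hlam hb hB hE t x a)).1
    unfold ucb; linarith
  have h1 : P.regret (R.x t) (R.a t) ≤
      P.degradation R t (R.a t) (R.x t) + 2 * P.h R t * P.width R t (R.x t) (R.a t) := by
    have hsup : (⨆ a' : P.arms, P.f (R.x t) a') ≤ ⨆ a' : P.arms, P.ucb R t (R.x t) a' :=
      ciSup_mono (bddAbove_range_of_abs_le (hc _ hx.1)) fun a' => hucb_lo _ _
    have := hucb_hi (R.x t) (R.a t)
    unfold regret degradation
    linarith
  have h2 : P.degradation R t (R.a t) (R.x t) ≤ P.worstDegradation R t (R.a t) :=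
    le_ciSup (f := fun x : P.region R t => P.degradation R t (R.a t) x)
      ⟨2 * c, by rintro _ ⟨x, rfl⟩; exact iSup_sub_le_two_mul (hc _ x.2.1) hal⟩ ⟨R.x t, hx⟩
  have h3 := halmin at_ hat
  have h4 : P.worstDegradation R t at_ ≤ P.degradation R t at_ (xd t) :=
    ciSup_le fun x => hmax x x.2
  have h5 : P.degradation R t at_ (xd t) ≤
      P.regret (xd t) at_ + 2 * P.h R t * P.width R t (xd t) (ad t) := by
    have hs1 : (⨆ a' : P.arms, P.ucb R t (xd t) a') ≤ P.ucb R t (xd t) (ad t) :=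
      ciSup_le fun a' => hbest a' a'.2
    have hs2 : P.f (xd t) (ad t) ≤ ⨆ a' : P.arms, P.f (xd t) a' :=
      le_ciSup (f := fun a' : P.arms => P.f (xd t) a')
        (bddAbove_range_of_abs_le fun a' ha' => abs_f_le hfeat hxd.1 ha') ⟨_, had⟩
    have := hucb_lo (xd t) at_
    have := hucb_hi (xd t) (ad t)
    unfold regret degradation
    linarith
  have h6 : P.regret (xd t) at_ ≤ P.worstRegret R t at_ :=
    le_ciSup (f := fun x : P.region R t => P.regret x at_)
      ⟨2 * ‖P.theta‖, by
        rintro _ ⟨x, rfl⟩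
        exact iSup_sub_le_two_mul (fun a ha => abs_f_le hfeat x.2.1 ha) hat⟩ ⟨xd t, hxd⟩
  have h7 : P.worstRegret R t at_ ≤ P.MR R t := le_ciInf fun a => hmin a a.2
  linarith

lemma mem_space (htrue : ∀ t, 1 ≤ t → R.x t ∈ P.region R t) (halg : P.IsMinWD R) {t : ℕ}
    (ht : 1 ≤ t) : R.z t ∈ P.space := ⟨_, (htrue t ht).1, _, (halg t ht).1, rfl⟩

lemma cumRegret_le (hlam : 0 < P.lam) (hb : 0 ≤ P.b) (hB : ‖P.theta‖ ≤ P.B)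
    (hfeat : ∀ z ∈ P.space, ‖P.feat z‖ ≤ 1) (hE : P.NoiseBound R)
    (htrue : ∀ t, 1 ≤ t → R.x t ∈ P.region R t) (halg : P.IsMinWD R) {xd : ℕ → Vec p}
    {ad : ℕ → Vec r} (hcons : P.IsConsidered R xd ad) (T : ℕ) :
    P.cumRegret R T ≤ ∑ t ∈ Finset.Icc 1 T, P.MR R t +
      2 * P.h R T * ∑ i ∈ Finset.range T,
        covNorm P.lam (P.vec R) i (P.feat (concat (xd (i + 1)) (ad (i + 1)))) +
      2 * P.h R T * ∑ i ∈ Finset.range T, covNorm P.lam (P.vec R) i (P.vec R i) := by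
  have hshift : ∀ F : ℕ → ℝ, ∑ i ∈ Finset.range T, F (i + 1) = ∑ t ∈ Finset.Icc 1 T, F t := by
    intro F
    rw [Finset.range_eq_Ico, Finset.sum_Ico_add' F 0 T 1]
    rfl
  have h1 : ∀ i, covNorm P.lam (P.vec R) i (P.feat (concat (xd (i + 1)) (ad (i + 1)))) =
      P.width R (i + 1) (xd (i + 1)) (ad (i + 1)) := fun i =>
    (P.width_eq R hlam (i + 1) _ _).symm
  have h2 : ∀ i, covNorm P.lam (P.vec R) i (P.vec R i) =
      P.width R (i + 1) (R.x (i + 1)) (R.a (i + 1)) := fun i =>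
    (P.width_eq R hlam (i + 1) _ _).symm
  simp_rw [h1, h2]
  rw [hshift fun t => P.width R t (xd t) (ad t), hshift fun t => P.width R t (R.x t) (R.a t),
    Finset.mul_sum, Finset.mul_sum, ← Finset.sum_add_distrib, ← Finset.sum_add_distrib, cumRegret]
  refine Finset.sum_le_sum fun t ht => ?_
  rw [Finset.mem_Icc] at ht
  refine (regret_le hlam hb hB hfeat hE htrue halg hcons ht.1).trans ?_
  have := h_mono (R := R) hlam hb ht.2
  rw [add_assoc]
  gcongr
  · exact width_nonneg ..
  · exact width_nonneg ..

lemma sum_le_sqrt_mul (F : ℕ → ℝ) (T : ℕ) {c : ℝ}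
    (h : ∑ i ∈ Finset.range T, F i ^ 2 ≤ c) : ∑ i ∈ Finset.range T, F i ≤ √(T * c) := by
  refine Real.le_sqrt_of_sq_le ?_
  have h1 := sq_sum_le_card_mul_sum_sq (s := Finset.range T) (f := F)
  rw [Finset.card_range] at h1
  exact h1.trans (by gcongr)

lemma sum_width_true_le (hlam : 1 ≤ P.lam)
    (hfeat : ∀ z ∈ P.space, ‖P.feat z‖ ≤ 1)
    (htrue : ∀ t, 1 ≤ t → R.x t ∈ P.region R t) (halg : P.IsMinWD R) (T : ℕ) :
    ∑ i ∈ Finset.range T, covNorm P.lam (P.vec R) i (P.vec R i) ≤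
      √(T * (2 * rankLog P.lam T (P.dbar R T))) := by
  refine sum_le_sqrt_mul _ T ?_
  simp_rw [covNorm_sq (zero_lt_one.trans_le hlam)]
  rw [dbar_eq]
  exact sum_inner_covInv_le_rankLog hlam _ _ fun i _ => hfeat _ (mem_space htrue halg (by omega))

end Problem

end RobustBandit

/-! ### Recurrence, matchings and the widths at the considered vectors -/

namespace RobustBandit

section Recurrence

variable {p r : ℕ} {κ ε : ℝ} {C : Finset (CtxArm p r)} {z zd : ℕ → CtxArm p r}

/-- In a window of one period after any round, every cell is visited: by the successor of the last
visit before the window, or by the first visit. -/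
lemma IsRecurrent.exists_visit (h : IsRecurrent κ ε C z) {c : CtxArm p r} (hc : c ∈ C) {s : ℕ}
    (hs : 1 ≤ s) : ∃ t, s ≤ t ∧ t < s + period (p + r) κ ε ∧ ‖z t - c‖ ≤ ε := by
  induction s, hs using Nat.le_induction with
  | base =>
    obtain ⟨t, h1, h2, h3⟩ := h.1 c hc
    exact ⟨t, h1, by omega, h3⟩
  | succ s hs ih =>
    obtain ⟨t, h1, h2, h3⟩ := ih
    rcases h1.eq_or_lt with rfl | h4
    · obtain ⟨t', h5, h6, h7⟩ := h.2 c hc s hs h3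
      exact ⟨t', h5, by omega, h7⟩
    · exact ⟨t, h4, by omega, h3⟩

lemma IsRecurrent.exists_matching (h : IsRecurrent κ ε C z) {S : Set (CtxArm p r)}
    (hC : IsCovering S ε C) (hzd : ∀ t, 1 ≤ t → zd t ∈ S) (T : ℕ) :
    ∃ ζ, IsMatching ε C z zd (period (p + r) κ ε) T ζ := by
  have key : ∀ s, ∃ t, 1 ≤ s → s ≤ t ∧ t < s + period (p + r) κ ε ∧
      ∃ c ∈ C, ‖zd s - c‖ ≤ ε ∧ ‖z t - c‖ ≤ ε := by
    intro s
    by_cases hs : 1 ≤ s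
    · obtain ⟨c, hc, hcs⟩ := hC.2 _ (hzd s hs)
      obtain ⟨t, h1, h2, h3⟩ := h.exists_visit hc hs
      exact ⟨t, fun _ => ⟨h1, h2, c, hc, hcs, h3⟩⟩
    · exact ⟨0, fun h => absurd h hs⟩
  choose ζ hζ using key
  exact ⟨ζ, fun s hs _ => hζ s hs⟩

lemma IsRecurrent.period_pos (h : IsRecurrent κ ε C z) {S : Set (CtxArm p r)}
    (hC : IsCovering S ε C) (hS : S.Nonempty) : 0 < period (p + r) κ ε := by
  obtain ⟨z, hz⟩ := hS
  obtain ⟨c, hc, -⟩ := hC.2 z hz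
  obtain ⟨t, h1, h2, -⟩ := h.1 c hc
  omega

lemma scale_pow {d : ℕ} (hd : 0 < d) {κ : ℝ} (hκ : 0 ≤ κ) (T : ℕ) :
    scale d κ T ^ d = κ / √T := by
  have hd' : (d : ℝ) ≠ 0 := by positivity
  rw [scale, ← Real.rpow_natCast, ← Real.rpow_mul (by positivity)]
  have : 1 / (2 * (d : ℝ)) * d = 1 / 2 := by field_simp
  rw [this, ← Real.sqrt_eq_rpow, Real.sqrt_div (sq_nonneg _), Real.sqrt_sq hκ]

lemma scale_nonneg (d : ℕ) (κ : ℝ) (T : ℕ) : 0 ≤ scale d κ T := by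
  unfold scale; positivity

lemma period_scale {d : ℕ} (hd : 0 < d) {κ : ℝ} (hκ : 0 < κ) (T : ℕ) :
    period d κ (scale d κ T) = ⌈√(T : ℝ)⌉₊ := by
  rw [period, scale_pow hd hκ.le, div_div_cancel₀ hκ.ne']

lemma period_zero (d : ℕ) (ε : ℝ) : period d 0 ε = 0 := by
  simp [period]

lemma mul_scale (d : ℕ) {κ : ℝ} (hκ : 0 ≤ κ) {T : ℕ} (hT : 1 ≤ T) :
    (T : ℝ) * scale d κ T = κ ^ (1 / (d : ℝ)) * (T : ℝ) ^ (1 - 1 / (2 * (d : ℝ))) := by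
  have hT0 : (0 : ℝ) < T := by exact_mod_cast hT
  rw [scale, Real.div_rpow (by positivity) hT0.le, Real.rpow_sub hT0, Real.rpow_one,
    ← Real.rpow_natCast κ 2, ← Real.rpow_mul hκ]
  have : ((2 : ℕ) : ℝ) * (1 / (2 * (d : ℝ))) = 1 / d := by push_cast; field_simp
  rw [this]
  ring

end Recurrence

section CeilSqrt

/-- The elementary inequality behind the choice of `⌈√T⌉` blocks of length `T / ⌈√T⌉`. -/
lemma ceil_sqrt_mul_log_le {T : ℕ} (hT : 1 ≤ T) {c : ℝ} (hc0 : 0 ≤ c) (hc1 : c ≤ 1) :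
    (⌈√(T : ℝ)⌉₊ : ℝ) * Real.log (1 + ((T / ⌈√(T : ℝ)⌉₊ : ℕ) : ℝ) * c) ≤
      √T * Real.log (1 + T * c) := by
  have hT0 : (1 : ℝ) ≤ T := by exact_mod_cast hT
  set s := √(T : ℝ)
  have hs1 : 1 ≤ s := Real.one_le_sqrt.2 hT0
  have hs2 : s ^ 2 = T := Real.sq_sqrt (by positivity)
  have hq1 : s ≤ ⌈s⌉₊ := Nat.le_ceil s
  have hq2 : (⌈s⌉₊ : ℝ) < s + 1 := Nat.ceil_lt_add_one (by linarith)
  set q := ⌈s⌉₊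
  have hqM : (q : ℝ) * (T / q : ℕ) ≤ T := by exact_mod_cast Nat.mul_div_le T q
  have hMT : ((T / q : ℕ) : ℝ) ≤ s := by
    have : s * (T / q : ℕ) ≤ s * s := by
      rw [← sq, hs2]
      exact (mul_le_mul_of_nonneg_right hq1 (Nat.cast_nonneg _)).trans hqM
    exact le_of_mul_le_mul_left this (by linarith)
  have hM0 : (0 : ℝ) ≤ (T / q : ℕ) := Nat.cast_nonneg _
  set M : ℝ := ((T / q : ℕ) : ℝ) with hM
  have hq0 : 0 < q := by
    have : (0 : ℝ) < q := by linarith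
    exact_mod_cast this
  -- The polynomial inequality that remains after Bernoulli's inequality; the excess `q - s < 1`
  -- is harmless for `4 ≤ T`, and the three smaller values have `M = 1`.
  have hpoly : q * M + (q - s) * M ^ 2 ≤ T * s := by
    rcases le_or_gt 4 T with h4 | h4
    · have h4' : (4 : ℝ) ≤ T := by exact_mod_cast h4
      have hs4 : 2 ≤ s := by nlinarith
      have hM2 : M ^ 2 ≤ T := by rw [← hs2]; gcongr
      have : (q - s) * M ^ 2 ≤ 1 * T := by gcongr; linarith
      nlinarith
    · rcases (by omega : T = 1 ∨ T = 2 ∨ T = 3) with rfl | h23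
      · have h1 : s = 1 := by simp [s]
        have hq : q = 1 := by simp [q, h1]
        rw [hM, h1, hq]; norm_num
      · have hs23 : (1.4 : ℝ) ≤ s := Real.le_sqrt_of_sq_le (by
          rcases h23 with rfl | rfl <;> norm_num)
        have hT2 : (2 : ℝ) ≤ T := by rcases h23 with rfl | rfl <;> norm_num
        have hs24 : s ≤ 2 := Real.sqrt_le_iff.2 ⟨by norm_num, by
          rcases h23 with rfl | rfl <;> norm_num⟩
        have hq : q = 2 := by
          refine (Nat.ceil_eq_iff (by norm_num)).2 ⟨?_, by exact_mod_cast hs24⟩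
          push_cast; linarith
        have hM1 : M = 1 := by rw [hM, hq]; rcases h23 with rfl | rfl <;> norm_num
        rw [hM1, hq]
        push_cast
        nlinarith
  set α : ℝ := q / s
  have hs0 : 0 < s := by linarith
  have hα1 : 1 ≤ α := (one_le_div hs0).2 hq1
  have hα2 : α ≤ 2 := (div_le_iff₀ hs0).2 (by linarith)
  have hx : 0 ≤ M * c := mul_nonneg hM0 hc0
  have h1 := rpow_one_add_le_one_add_mul_self (s := M * c) (by linarith) (p := α - 1)
    (by linarith) (by linarith)
  have h2 := Real.log_le_log (by positivity) h1
  rw [Real.log_rpow (by linarith)] at h2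
  have h3 : Real.log (1 + M * c) + Real.log (1 + (α - 1) * (M * c)) ≤ Real.log (1 + T * c) := by
    have h0 : 0 ≤ (α - 1) * (M * c) := mul_nonneg (by linarith) hx
    rw [← Real.log_mul (by linarith) (by linarith)]
    refine Real.log_le_log (mul_pos (by linarith) (by linarith)) ?_
    have h4 : α * M + (α - 1) * M ^ 2 ≤ T := by
      have : α * M + (α - 1) * M ^ 2 = (q * M + (q - s) * M ^ 2) / s := by
        simp only [α]; field_simp
      rw [this]
      exact (div_le_iff₀ hs0).2 hpoly
    have h5 : (α - 1) * M ^ 2 * c ^ 2 ≤ (α - 1) * M ^ 2 * c := by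
      refine mul_le_mul_of_nonneg_left ?_ (mul_nonneg (by linarith) (sq_nonneg _))
      nlinarith
    nlinarith
  have h6 : (q : ℝ) = s * α := by simp only [α]; field_simp
  rw [h6, mul_assoc]
  refine mul_le_mul_of_nonneg_left ?_ hs0.le
  linarith

lemma ceil_sqrt_mul_rankLog_le {T : ℕ} (hT : 1 ≤ T) {lam : ℝ} (hlam : 1 ≤ lam) (u : ℕ) :
    (⌈√(T : ℝ)⌉₊ : ℝ) * rankLog lam ((T / ⌈√(T : ℝ)⌉₊ : ℕ) : ℝ) u ≤ √T * rankLog lam T u := by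
  rcases Nat.eq_zero_or_pos u with rfl | hu
  · simp [rankLog]
  have hu1 : (1 : ℝ) ≤ u := by exact_mod_cast hu
  have h1 := ceil_sqrt_mul_log_le hT (c := ((u : ℝ) * lam)⁻¹) (by positivity)
    (inv_le_one_of_one_le₀ (by nlinarith))
  rw [rankLog, rankLog, div_eq_mul_inv, div_eq_mul_inv]
  have := mul_le_mul_of_nonneg_left h1 (by positivity : (0 : ℝ) ≤ u)
  linarith

lemma sqrt_add_le_add_sqrt {x y : ℝ} (hx : 0 ≤ x) (hy : 0 ≤ y) : √(x + y) ≤ √x + √y := by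
  refine Real.sqrt_le_iff.2 ⟨by positivity, ?_⟩
  rw [add_sq, Real.sq_sqrt hx, Real.sq_sqrt hy]
  have : 0 ≤ 2 * √x * √y := by positivity
  linarith

lemma sum_range_mul_add (F : ℕ → ℝ) (M q : ℕ) :
    ∑ s ∈ Finset.range (M * q), F s =
      ∑ l ∈ Finset.range q, ∑ i ∈ Finset.range M, F (i * q + l) := by
  induction M with
  | zero => simp
  | succ M ih =>
    rw [Nat.succ_mul, Finset.sum_range_add, ih, ← Finset.sum_add_distrib]
    exact Finset.sum_congr rfl fun l _ => (Finset.sum_range_succ _ _).symm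

end CeilSqrt

namespace Problem

variable {p r : ℕ} {H : Type*} [NormedAddCommGroup H] [InnerProductSpace ℝ H]
  {P : Problem p r H} {R : Run p r} {L : ℝ≥0} {ε : ℝ} {C : Finset (CtxArm p r)}
  {zd : ℕ → CtxArm p r} {q T : ℕ} {ζ : ℕ → ℕ}

/-- One group of the matching: for the rounds `l + 1, l + 1 + q, …` the matched rounds are
increasing and each precedes the next round of the group, so the widths at the considered vectors are
bounded by the widths built from the matched vectors alone, up to the diameter of a cell. -/
lemma sum_group_le (hlam : 1 ≤ P.lam) (hfeat : ∀ z ∈ P.space, ‖P.feat z‖ ≤ 1)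
    (hLip : LipschitzOnWith L P.feat P.space) (hz : ∀ t, 1 ≤ t → R.z t ∈ P.space)
    (hzd : ∀ t, 1 ≤ t → zd t ∈ P.space) (hζ : IsMatching ε C R.z zd q T ζ) {l : ℕ} (hl : l < q) :
    ∑ i ∈ Finset.range (T / q),
        covNorm P.lam (P.vec R) (i * q + l) (P.feat (zd (i * q + l + 1))) ^ 2 ≤
      4 * rankLog P.lam ((T / q : ℕ) : ℝ) (P.dtilde R q T ζ) +
        (T / q : ℕ) * (8 * ε ^ 2 * L ^ 2 / P.lam) := by
  have hlam0 : 0 < P.lam := by linarith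
  set M := T / q
  set w : ℕ → H := fun i => P.feat (R.z (ζ (l + 1 + i * q)))
  have hrange : ∀ i < M, 1 ≤ l + 1 + i * q ∧ l + 1 + i * q ≤ M * q := by
    intro i hi
    have : (i + 1) * q ≤ M * q := Nat.mul_le_mul_right q hi
    rw [Nat.succ_mul] at this
    exact ⟨by omega, by omega⟩
  have hm := fun i hi => hζ (l + 1 + i * q) (hrange i hi).1 (hrange i hi).2
  have hzζ : ∀ i < M, R.z (ζ (l + 1 + i * q)) ∈ P.space := fun i hi =>
    hz _ ((hrange i hi).1.trans (hm i hi).1)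
  have hlt : ∀ j i, j < i → i < M → ζ (l + 1 + j * q) < l + 1 + i * q := by
    intro j i hji hi
    have h1 := (hm j (hji.trans hi)).2.1
    have : (j + 1) * q ≤ i * q := Nat.mul_le_mul_right q hji
    rw [Nat.succ_mul] at this
    omega
  have hstep : ∀ i < M, covNorm P.lam (P.vec R) (i * q + l) (P.feat (zd (i * q + l + 1))) ^ 2 ≤
      2 * ⟪w i, covInv P.lam w i (w i)⟫ + 8 * ε ^ 2 * L ^ 2 / P.lam := by
    intro i hi
    have hmono : covNorm P.lam (P.vec R) (i * q + l) (P.feat (zd (i * q + l + 1))) ≤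
        covNorm P.lam w i (P.feat (zd (i * q + l + 1))) := by
      refine covNorm_mono hlam0 _ _ _ _ (fun x => ?_) _
      have hinj : Set.InjOn (fun j => ζ (l + 1 + j * q) - 1) (Finset.range i) := by
        have hlt' : ∀ j j', j < j' → j' < i →
            ζ (l + 1 + j * q) - 1 < ζ (l + 1 + j' * q) - 1 := by
          intro j j' hj hj'
          have h1 := hlt j j' hj (hj'.trans hi)
          have h2 := (hm j' (hj'.trans hi)).1
          have h3 := (hm j ((hj.trans hj').trans hi)).1
          omega
        intro j hj j' hj' he
        simp only [Finset.coe_range, Set.mem_Iio] at hj hj'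
        rcases lt_trichotomy j j' with h | h | h
        · exact absurd he (hlt' j j' h hj').ne
        · exact h
        · exact absurd he (hlt' j' j h hj).ne'
      calc ∑ j ∈ Finset.range i, ⟪w j, x⟫ ^ 2
          = ∑ j ∈ Finset.range i, ⟪P.vec R (ζ (l + 1 + j * q) - 1), x⟫ ^ 2 := by
            refine Finset.sum_congr rfl fun j hj => ?_
            have h1 := (hm j ((Finset.mem_range.1 hj).trans hi)).1
            simp only [w, vec]
            rw [Nat.sub_add_cancel (by omega)]
        _ = ∑ k ∈ (Finset.range i).image (fun j => ζ (l + 1 + j * q) - 1),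
              ⟪P.vec R k, x⟫ ^ 2 :=
            (Finset.sum_image (f := fun k => ⟪P.vec R k, x⟫ ^ 2) hinj).symm
        _ ≤ ∑ k ∈ Finset.range (i * q + l), ⟪P.vec R k, x⟫ ^ 2 := by
            refine Finset.sum_le_sum_of_subset_of_nonneg ?_ fun _ _ _ => sq_nonneg _
            intro k hk
            obtain ⟨j, hj, rfl⟩ := Finset.mem_image.1 hk
            have h1 := hlt j i (Finset.mem_range.1 hj) hi
            have h2 := (hm j ((Finset.mem_range.1 hj).trans hi)).1
            rw [Finset.mem_range]
            omega
    have hclose : ‖P.feat (zd (i * q + l + 1)) - w i‖ ≤ L * (2 * ε) := by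
      have hi1 : i * q + l + 1 = l + 1 + i * q := by ring
      obtain ⟨-, -, c, -, hc1, hc2⟩ := hm i hi
      rw [hi1, ← dist_eq_norm]
      refine (hLip.dist_le_mul _ (hzd _ (by omega)) _ (hzζ i hi)).trans ?_
      gcongr
      have := dist_triangle_right (zd (l + 1 + i * q)) (R.z (ζ (l + 1 + i * q))) c
      rw [dist_eq_norm _ c, dist_eq_norm _ c] at this
      linarith
    have htri : covNorm P.lam w i (P.feat (zd (i * q + l + 1))) ≤
        covNorm P.lam w i (w i) + (√P.lam)⁻¹ * (L * (2 * ε)) := by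
      have h1 := covNorm_add_le hlam0 w i (w i) (P.feat (zd (i * q + l + 1)) - w i)
      rw [add_sub_cancel] at h1
      refine h1.trans (add_le_add le_rfl ((covNorm_le hlam0 _ _ _).trans ?_))
      gcongr
    calc _ ≤ (covNorm P.lam w i (w i) + (√P.lam)⁻¹ * (L * (2 * ε))) ^ 2 :=
          pow_le_pow_left₀ (covNorm_nonneg ..) (hmono.trans htri) 2
      _ ≤ 2 * (covNorm P.lam w i (w i) ^ 2 + ((√P.lam)⁻¹ * (L * (2 * ε))) ^ 2) := add_sq_le
      _ = _ := by
        rw [covNorm_sq hlam0, mul_pow, inv_pow, Real.sq_sqrt hlam0.le]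
        ring
  calc _ ≤ ∑ i ∈ Finset.range M,
        (2 * ⟪w i, covInv P.lam w i (w i)⟫ + 8 * ε ^ 2 * L ^ 2 / P.lam) :=
        Finset.sum_le_sum fun i hi => hstep i (Finset.mem_range.1 hi)
    _ = 2 * ∑ i ∈ Finset.range M, ⟪w i, covInv P.lam w i (w i)⟫ +
          M * (8 * ε ^ 2 * L ^ 2 / P.lam) := by
        rw [Finset.sum_add_distrib, ← Finset.mul_sum]; simp
    _ ≤ _ := by
        have h1 := sum_inner_covInv_le_rankLog hlam w M fun i hi => hfeat _ (hzζ i hi)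
        have h2 : (Matrix.gram ℝ fun i : Fin M => w i).rank ≤ P.dtilde R q T ζ :=
          Finset.le_sup (f := fun l => (Matrix.of fun i j : Fin (T / q) =>
            P.kern (R.z (ζ (l + i * q))) (R.z (ζ (l + j * q)))).rank)
            (Finset.mem_Icc.2 ⟨by omega, by omega⟩ : l + 1 ∈ Finset.Icc 1 q)
        have h3 := rankLog_mono_rank (T := M) hlam0 (Nat.cast_nonneg _) (Nat.cast_nonneg _)
          (Nat.cast_le.2 h2 : ((Matrix.gram ℝ fun i : Fin M => w i).rank : ℝ) ≤ _)
        linarith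

/-- The widths at the considered vectors, summed over all rounds. -/
lemma sum_width_considered_le (hlam : 1 ≤ P.lam) (hfeat : ∀ z ∈ P.space, ‖P.feat z‖ ≤ 1)
    (hLip : LipschitzOnWith L P.feat P.space) (hz : ∀ t, 1 ≤ t → R.z t ∈ P.space)
    (hzd : ∀ t, 1 ≤ t → zd t ∈ P.space) (hε : 0 ≤ ε) (hT : 1 ≤ T) (hq : q = ⌈√(T : ℝ)⌉₊)
    (hζ : IsMatching ε C R.z zd q T ζ) :
    ∑ i ∈ Finset.range T, covNorm P.lam (P.vec R) i (P.feat (zd (i + 1))) ≤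
      (T : ℝ) ^ (3 / 4 : ℝ) * √(4 * rankLog P.lam T (P.dtilde R q T ζ) + 1 / P.lam) +
        2 * √(2 / P.lam) * L * (T * ε) := by
  have hlam0 : 0 < P.lam := by linarith
  have hT0 : (1 : ℝ) ≤ T := by exact_mod_cast hT
  set F : ℕ → ℝ := fun i => covNorm P.lam (P.vec R) i (P.feat (zd (i + 1)))
  set G := rankLog P.lam T (P.dtilde R q T ζ)
  have hG : 0 ≤ G := rankLog_nonneg hlam0 (by positivity) (Nat.cast_nonneg _)
  set M := T / q with hM
  set e := 8 * ε ^ 2 * L ^ 2 / P.lam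
  have he : 0 ≤ e := by positivity
  have hF : ∀ i, F i ^ 2 ≤ 1 / P.lam := by
    intro i
    rw [covNorm_sq hlam0, one_div]
    refine (inner_covInv_self_le hlam0 _ _ _).trans
      (mul_le_of_le_one_right (by positivity) ?_)
    exact pow_le_one₀ (norm_nonneg _) (hfeat _ (hzd _ (by omega)))
  have hq1 : √(T : ℝ) ≤ q := hq ▸ Nat.le_ceil _
  have hq2 : (q : ℝ) < √T + 1 := hq ▸ Nat.ceil_lt_add_one (Real.sqrt_nonneg _)
  have hq0 : 0 < q := by
    have : 1 ≤ √(T : ℝ) := Real.one_le_sqrt.2 hT0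
    have : (0 : ℝ) < q := by linarith
    exact_mod_cast this
  -- the complete groups, and the fewer than `q` rounds after them
  have hmain : ∑ i ∈ Finset.range (M * q), F i ^ 2 ≤
      q * (4 * rankLog P.lam M (P.dtilde R q T ζ) + M * e) := by
    rw [sum_range_mul_add fun i => F i ^ 2]
    calc _ ≤ ∑ _l ∈ Finset.range q, (4 * rankLog P.lam M (P.dtilde R q T ζ) + M * e) :=
          Finset.sum_le_sum fun l hl =>
            sum_group_le hlam hfeat hLip hz hzd hζ (Finset.mem_range.1 hl)
      _ = _ := by rw [Finset.sum_const, Finset.card_range, nsmul_eq_mul]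
  have hrest : ∑ i ∈ Finset.range (T % q), F (M * q + i) ^ 2 ≤ √T * (1 / P.lam) := by
    calc _ ≤ ∑ _i ∈ Finset.range (T % q), 1 / P.lam := Finset.sum_le_sum fun i _ => hF _
      _ = (T % q : ℕ) * (1 / P.lam) := by simp
      _ ≤ √T * (1 / P.lam) := by
        gcongr
        have : T % q + 1 ≤ q := Nat.mod_lt _ hq0
        have : ((T % q : ℕ) : ℝ) + 1 ≤ q := by exact_mod_cast this
        linarith
  have hqG : q * rankLog P.lam M (P.dtilde R q T ζ) ≤ √T * G := by
    have := ceil_sqrt_mul_rankLog_le hT hlam (P.dtilde R q T ζ)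
    rwa [← hq] at this
  have hqM : (q : ℝ) * M ≤ T := by exact_mod_cast Nat.mul_div_le T q
  have htotal : ∑ i ∈ Finset.range T, F i ^ 2 ≤ √T * (4 * G + 1 / P.lam) + T * e := by
    have hsplit : T = M * q + T % q := by rw [mul_comm]; exact (Nat.div_add_mod T q).symm
    have h1 : ∑ i ∈ Finset.range T, F i ^ 2 = ∑ i ∈ Finset.range (M * q), F i ^ 2 +
        ∑ i ∈ Finset.range (T % q), F (M * q + i) ^ 2 := by
      rw [← Finset.sum_range_add, ← hsplit]
    have h2 : (q : ℝ) * M * e ≤ T * e := by gcongr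
    rw [h1]
    linarith
  refine (sum_le_sqrt_mul F T htotal).trans ?_
  rw [mul_add]
  refine (sqrt_add_le_add_sqrt (by positivity) (by positivity)).trans
    (add_le_add (le_of_eq ?_) (le_of_eq ?_))
  · rw [← mul_assoc, Real.sqrt_mul (by positivity)]
    congr 1
    rw [Real.sqrt_eq_rpow, Real.sqrt_eq_rpow]
    nth_rewrite 1 [← Real.rpow_one (T : ℝ)]
    rw [← Real.rpow_add (by linarith), ← Real.rpow_mul (by linarith)]
    norm_num
  · have h1 : (T : ℝ) * (T * e) = (2 * L * (T * ε)) ^ 2 * (2 / P.lam) := by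
      simp only [e]; ring
    rw [h1, Real.sqrt_mul (sq_nonneg _), Real.sqrt_sq (by positivity)]
    ring

end Problem

end RobustBandit

/-! ### Growth of the bound and measurability of the kernel -/

namespace RobustBandit

section Growth

lemma sqrt_le_one_add {x : ℝ} (hx : 0 ≤ x) : √x ≤ 1 + x :=
  Real.sqrt_le_iff.2 ⟨by linarith, by nlinarith⟩

lemma rankLog_le {lam T : ℝ} (hlam : 1 ≤ lam) (hT : 0 ≤ T) {u D : ℕ} (h : u ≤ D) :
    rankLog lam T u ≤ D * (1 + Real.log (1 + T)) := by
  have hlam0 : 0 < lam := by linarith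
  refine (rankLog_mono_rank hlam0 hT (Nat.cast_nonneg u) (Nat.cast_le.2 h)).trans ?_
  rcases Nat.eq_zero_or_pos D with rfl | hD
  · simp [rankLog]
  have hD1 : (1 : ℝ) ≤ D := by exact_mod_cast hD
  have h1 : T / (D * lam) ≤ T := div_le_self hT (by nlinarith)
  have h2 : Real.log (1 + T / (D * lam)) ≤ Real.log (1 + T) :=
    Real.log_le_log (by positivity) (by linarith)
  rw [rankLog]
  gcongr
  linarith

lemma isLittleO_rpow_mul_sq_log {a : ℝ} (ha : a < 1) :
    (fun T : ℕ => (1 + Real.log (1 + (T : ℝ))) ^ 2 * (T : ℝ) ^ a) =o[atTop]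
      fun T : ℕ => (T : ℝ) := by
  -- `1 + log (1 + T) = O(T ^ s)`, with the exponent chosen such that `a + 2 s = (1 + a) / 2 < 1`
  set s := (1 - a) / 4 with hs
  have hs0 : 0 < s := by rw [hs]; linarith
  have hbig : (fun T : ℕ => (1 + Real.log (1 + (T : ℝ))) ^ 2 * (T : ℝ) ^ a) =O[atTop]
      fun T : ℕ => (T : ℝ) ^ ((1 + a) / 2) := by
    refine IsBigO.of_bound (((1 + 1 / s) * 2 ^ s) ^ 2) ?_
    filter_upwards [eventually_ge_atTop 1] with T hT
    have hT1 : (1 : ℝ) ≤ T := by exact_mod_cast hT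
    have hlog0 : 0 ≤ Real.log (1 + (T : ℝ)) := Real.log_nonneg (by linarith)
    have h1 : 1 + Real.log (1 + (T : ℝ)) ≤ (1 + 1 / s) * 2 ^ s * (T : ℝ) ^ s := by
      have h2 := Real.log_le_rpow_div (x := 1 + (T : ℝ)) (by linarith) hs0
      have h3 : 1 ≤ (1 + (T : ℝ)) ^ s := Real.one_le_rpow (by linarith) hs0.le
      have h4 : (1 + (T : ℝ)) ^ s ≤ 2 ^ s * (T : ℝ) ^ s := by
        rw [← Real.mul_rpow (by norm_num) (by linarith)]
        exact Real.rpow_le_rpow (by linarith) (by linarith) hs0.le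
      calc _ ≤ (1 + 1 / s) * (1 + (T : ℝ)) ^ s := by
            rw [add_mul, one_mul, one_div, inv_mul_eq_div]; linarith
        _ ≤ _ := by rw [mul_assoc]; gcongr
    rw [Real.norm_of_nonneg (by positivity), Real.norm_of_nonneg (by positivity)]
    calc _ ≤ ((1 + 1 / s) * 2 ^ s * (T : ℝ) ^ s) ^ 2 * (T : ℝ) ^ a := by gcongr
      _ = ((1 + 1 / s) * 2 ^ s) ^ 2 * (((T : ℝ) ^ s) ^ 2 * (T : ℝ) ^ a) := by ring
      _ = _ := by
        rw [← Real.rpow_natCast ((T : ℝ) ^ s), ← Real.rpow_mul (by linarith),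
          ← Real.rpow_add (by linarith)]
        congr 2
        rw [hs]; push_cast; ring
  refine hbig.trans_isLittleO ((isLittleO_iff_tendsto' ?_).2 ?_)
  · filter_upwards [eventually_ge_atTop 1] with T hT h0
    exact absurd h0 (by positivity)
  · have h1 := (tendsto_rpow_neg_atTop (show 0 < (1 - a) / 2 by linarith)).comp
      (tendsto_natCast_atTop_atTop (R := ℝ))
    refine h1.congr' ?_
    filter_upwards [eventually_ge_atTop 1] with T hT
    have hT0 : (0 : ℝ) < T := by exact_mod_cast hT
    rw [← Real.rpow_sub_one hT0.ne', Function.comp_apply]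
    congr 1
    ring

end Growth

namespace Problem

variable {p r : ℕ} {H : Type*} [NormedAddCommGroup H] [InnerProductSpace ℝ H]
  {P : Problem p r H} {R : Run p r} {L : ℝ≥0}

/-- The regret bound on a run with the noise bound. -/
lemma cumRegret_le_of_isMatching (hd : 0 < p + r) (hlam : 1 ≤ P.lam) (hb : 0 ≤ P.b)
    (hB : ‖P.theta‖ ≤ P.B) (hfeat : ∀ z ∈ P.space, ‖P.feat z‖ ≤ 1)
    (hLip : LipschitzOnWith L P.feat P.space) (hE : P.NoiseBound R)
    (htrue : ∀ t, 1 ≤ t → R.x t ∈ P.region R t) (halg : P.IsMinWD R) {xd : ℕ → Vec p}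
    {ad : ℕ → Vec r} (hcons : P.IsConsidered R xd ad) {T : ℕ} (hT : 1 ≤ T) {κ : ℝ} (hκ : 0 ≤ κ)
    {C : Finset (CtxArm p r)} (hC : IsCovering P.space (scale (p + r) κ T) C)
    (hrec : IsRecurrent κ (scale (p + r) κ T) C R.z) {ζ : ℕ → ℕ}
    (hζ : IsMatching (scale (p + r) κ T) C R.z (fun t => concat (xd t) (ad t))
      (period (p + r) κ (scale (p + r) κ T)) T ζ) :
    P.cumRegret R T ≤ ∑ t ∈ Finset.Icc 1 T, P.MR R t +
      2 * P.h R T * (T : ℝ) ^ (3 / 4 : ℝ) *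
        √(4 * rankLog P.lam T
          (P.dtilde R (period (p + r) κ (scale (p + r) κ T)) T ζ) + 1 / P.lam) +
      4 * √(2 / P.lam) * L * κ ^ (1 / ((p + r : ℕ) : ℝ)) * P.h R T *
        (T : ℝ) ^ (1 - 1 / (2 * ((p + r : ℕ) : ℝ))) +
      2 * P.h R T * √(T * (2 * rankLog P.lam T (P.dbar R T))) := by
  have hlam0 : 0 < P.lam := by linarith
  have hz : ∀ t, 1 ≤ t → R.z t ∈ P.space := fun t ht => mem_space htrue halg ht
  have hzd : ∀ t, 1 ≤ t → concat (xd t) (ad t) ∈ P.space := fun t ht => by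
    obtain ⟨⟨_, _, _, hxd, _⟩, had, _⟩ := hcons t ht
    exact ⟨_, hxd.1, _, had, rfl⟩
  -- A recurrent run has a positive period, which excludes `κ = 0`.
  have hκ0 : 0 < κ := by
    refine hκ.lt_of_ne fun h => ?_
    subst h
    have := hrec.period_pos hC ⟨_, hz 1 le_rfl⟩
    rw [period_zero] at this
    exact lt_irrefl _ this
  have h1 := cumRegret_le hlam0 hb hB hfeat hE htrue halg hcons T
  have h2 := sum_width_considered_le hlam hfeat hLip hz hzd (scale_nonneg _ _ _) hT
    (period_scale hd hκ0 T) hζ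
  have h3 := sum_width_true_le hlam hfeat htrue halg T
  rw [mul_scale _ hκ hT] at h2
  have hh : 0 ≤ 2 * P.h R T := by have := h_nonneg (R := R) hb hB T; linarith
  have h4 := mul_le_mul_of_nonneg_left h2 hh
  have h5 := mul_le_mul_of_nonneg_left h3 hh
  rw [mul_add] at h4
  linarith

lemma dtilde_le {ε : ℝ} {C : Finset (CtxArm p r)} {zd : ℕ → CtxArm p r} {q T : ℕ} {ζ : ℕ → ℕ}
    (hζ : IsMatching ε C R.z zd q T ζ) : P.dtilde R q T ζ ≤ P.dbar R (T + q) := by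
  refine Finset.sup_le fun l hl => ?_
  rw [Finset.mem_Icc] at hl
  have hmem : ∀ i : Fin (T / q), ζ (l + i * q) ∈ Finset.Ico 1 (T + q + 1) := by
    intro i
    have h1 : (i + 1) * q ≤ T / q * q := Nat.mul_le_mul_right q i.2
    rw [Nat.succ_mul] at h1
    have h2 := Nat.div_mul_le_self T q
    obtain ⟨h3, h4, -⟩ := hζ (l + i * q) (by omega) (by omega)
    exact Finset.mem_Ico.2 ⟨by omega, by omega⟩
  exact Matrix.rank_submatrix_le (P.K R (T + q + 1))
    (fun i : Fin (T / q) => ⟨ζ (l + i * q), hmem i⟩) fun i : Fin (T / q) => ⟨ζ (l + i * q), hmem i⟩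

lemma h_le (hlam : 1 ≤ P.lam) (hb : 0 ≤ P.b) (hB : ‖P.theta‖ ≤ P.B) (hδ₀ : 0 < P.delta)
    (hδ₁ : P.delta < 1) (hfeat : ∀ z ∈ P.space, ‖P.feat z‖ ≤ 1)
    (hz : ∀ t, 1 ≤ t → R.z t ∈ P.space) {D : ℕ} (hD : ∀ T, P.dbar R T ≤ D) (T : ℕ) :
    P.h R T ≤ (√P.lam * P.B + P.b * (1 + D - 2 * Real.log P.delta)) *
      (1 + Real.log (1 + (T : ℝ))) := by
  have hlam0 : 0 < P.lam := by linarith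
  have hB0 : 0 ≤ P.B := (norm_nonneg _).trans hB
  have hδ : Real.log P.delta < 0 := Real.log_neg hδ₀ hδ₁
  have hlog : 0 ≤ Real.log (1 + (T : ℝ)) :=
    Real.log_nonneg (by have := Nat.cast_nonneg (α := ℝ) T; linarith)
  set Λ := 1 + Real.log (1 + (T : ℝ))
  have hΛ : 1 ≤ Λ := by simp only [Λ]; linarith
  have hγ0 : 0 ≤ P.gamma R T := log_det_nonneg (Matrix.posSemidef_gram ℝ _) hlam0
  have hγ : P.gamma R T ≤ D * Λ := by
    -- `γ_T ≤ γ_{T + 1}`, and the latter involves the kernel matrix of the first `T` rounds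
    have h1 : P.gamma R T ≤ P.gamma R (T + 1) := by
      rw [P.gamma_eq R hlam0, P.gamma_eq R hlam0]
      refine Finset.sum_le_sum_of_subset_of_nonneg ?_ fun i _ _ => Real.log_nonneg ?_
      · exact Finset.range_mono (by omega)
      · have := inner_covInv_self_nonneg hlam0 (P.vec R) i (P.vec R i)
        linarith
    refine h1.trans ((log_det_le_rankLog (T := T) (Matrix.posSemidef_gram ℝ _) hlam0 ?_).trans
      (rankLog_le hlam (Nat.cast_nonneg T) (hD T)))
    refine (trace_gram_le (fun i : Finset.Ico 1 (T + 1) => P.feat (R.z i))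
      fun i => hfeat _ (hz i (Finset.mem_Ico.1 i.2).1)).trans ?_
    simp
  unfold h
  have h2 : √(P.gamma R T - 2 * Real.log P.delta) ≤ (1 + D - 2 * Real.log P.delta) * Λ := by
    refine (sqrt_le_one_add (by linarith)).trans ?_
    nlinarith
  have h3 : √P.lam * P.B ≤ √P.lam * P.B * Λ := le_mul_of_one_le_right (by positivity) hΛ
  have h4 := mul_le_mul_of_nonneg_left h2 hb
  rw [add_mul, mul_assoc P.b]
  exact add_le_add h3 h4

/-- Bounded ranks make the logarithmic factors harmless, so the regret bound is sublinear. -/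
lemma typeIIRobust (hd : 0 < p + r) (hlam : 1 ≤ P.lam) (hb : 0 ≤ P.b)
    (hB : ‖P.theta‖ ≤ P.B) (hδ₀ : 0 < P.delta) (hδ₁ : P.delta < 1)
    (hfeat : ∀ z ∈ P.space, ‖P.feat z‖ ≤ 1)
    (hLip : LipschitzOnWith L P.feat P.space) (hE : P.NoiseBound R)
    (htrue : ∀ t, 1 ≤ t → R.x t ∈ P.region R t) (halg : P.IsMinWD R) {xd : ℕ → Vec p}
    {ad : ℕ → Vec r} (hcons : P.IsConsidered R xd ad) {κ : ℝ} (hκ : 0 ≤ κ)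
    (hrec : ∀ᶠ T : ℕ in atTop, ∃ C : Finset (CtxArm p r),
      IsCovering P.space (scale (p + r) κ T) C ∧ IsRecurrent κ (scale (p + r) κ T) C R.z)
    {D : ℕ} (hD : ∀ T, P.dbar R T ≤ D) : P.TypeIIRobust R := by
  have hlam0 : 0 < P.lam := by linarith
  have hz : ∀ t, 1 ≤ t → R.z t ∈ P.space := fun t ht => mem_space htrue halg ht
  have hzd : ∀ t, 1 ≤ t → concat (xd t) (ad t) ∈ P.space := fun t ht => by
    obtain ⟨⟨_, _, _, hxd, _⟩, had, _⟩ := hcons t ht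
    exact ⟨_, hxd.1, _, had, rfl⟩
  have hd1 : (1 : ℝ) ≤ ((p + r : ℕ) : ℝ) := by exact_mod_cast hd
  set d : ℝ := ((p + r : ℕ) : ℝ)
  set a : ℝ := max (3 / 4) (1 - 1 / (2 * d)) with ha
  have ha1 : a < 1 := max_lt (by norm_num) (by
    have : 0 < 1 / (2 * d) := by positivity
    linarith)
  have ha34 : 3 / 4 ≤ a := le_max_left _ _
  set ch := √P.lam * P.B + P.b * (1 + D - 2 * Real.log P.delta)
  set cκ := 4 * √(2 / P.lam) * L * κ ^ (1 / d)
  have hcκ : 0 ≤ cκ := by positivity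
  set c := 2 * ch * (2 + 4 * D) + cκ * ch + 2 * ch * (1 + 2 * D) with hc
  refine ⟨fun T => max (P.cumRegret R T - ∑ t ∈ Finset.Icc 1 T, P.MR R t) 0, ?_,
    fun T => le_max_left _ _⟩
  refine IsBigO.trans_isLittleO (IsBigO.of_bound c ?_)
    (isLittleO_rpow_mul_sq_log ha1)
  filter_upwards [hrec, eventually_ge_atTop 1] with T ⟨C, hC, hCrec⟩ hT
  obtain ⟨ζ, hζ⟩ := hCrec.exists_matching (zd := fun t => concat (xd t) (ad t)) hC hzd T
  have hmain := cumRegret_le_of_isMatching hd hlam hb hB hfeat hLip hE htrue halg hcons hT hκ hC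
    hCrec hζ
  have hT1 : (1 : ℝ) ≤ T := by exact_mod_cast hT
  have hlog : 0 ≤ Real.log (1 + (T : ℝ)) := Real.log_nonneg (by linarith)
  have hh := h_le hlam hb hB hδ₀ hδ₁ hfeat hz hD T
  have hh0 := h_nonneg (R := R) hb hB T
  have hr1 := rankLog_le (T := T) hlam (Nat.cast_nonneg T) ((dtilde_le (P := P) hζ).trans (hD _))
  have hr2 := rankLog_le (T := T) hlam (Nat.cast_nonneg T) (hD T)
  have hr10 := rankLog_nonneg (T := T) (u := P.dtilde R (period (p + r) κ (scale (p + r) κ T)) T ζ)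
    hlam0 (Nat.cast_nonneg T) (Nat.cast_nonneg _)
  have hr20 := rankLog_nonneg (T := T) (u := P.dbar R T) hlam0 (Nat.cast_nonneg T)
    (Nat.cast_nonneg _)
  set Λ := 1 + Real.log (1 + (T : ℝ))
  have hΛ : 1 ≤ Λ := by simp only [Λ]; linarith
  have hch : 0 ≤ ch := by
    have hB0 : 0 ≤ P.B := (norm_nonneg _).trans hB
    have hδ : Real.log P.delta < 0 := Real.log_neg hδ₀ hδ₁
    have : 0 ≤ 1 + D - 2 * Real.log P.delta := by
      have := Nat.cast_nonneg (α := ℝ) D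
      linarith
    positivity
  set g1 := rankLog P.lam T (P.dtilde R (period (p + r) κ (scale (p + r) κ T)) T ζ)
  set g2 := rankLog P.lam T (P.dbar R T)
  have hlinv : 1 / P.lam ≤ 1 := (div_le_one hlam0).2 hlam
  have hs1 : √(4 * g1 + 1 / P.lam) ≤ (2 + 4 * D) * Λ := by
    refine (sqrt_le_one_add (by positivity)).trans ?_
    nlinarith
  have hs2 : √(T * (2 * g2)) ≤ (T : ℝ) ^ a * ((1 + 2 * D) * Λ) := by
    rw [Real.sqrt_mul (by positivity)]
    refine mul_le_mul ?_ ((sqrt_le_one_add (by positivity)).trans (by nlinarith))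
      (Real.sqrt_nonneg _) (by positivity)
    rw [Real.sqrt_eq_rpow]
    exact Real.rpow_le_rpow_of_exponent_le hT1 (by linarith)
  have ht1 : (T : ℝ) ^ (3 / 4 : ℝ) ≤ (T : ℝ) ^ a := Real.rpow_le_rpow_of_exponent_le hT1 ha34
  have ht2 : (T : ℝ) ^ (1 - 1 / (2 * d)) ≤ (T : ℝ) ^ a :=
    Real.rpow_le_rpow_of_exponent_le hT1 (le_max_right _ _)
  set A := (T : ℝ) ^ a
  have hA : 0 ≤ A := by positivity
  have b1 : 2 * P.h R T * (T : ℝ) ^ (3 / 4 : ℝ) * √(4 * g1 + 1 / P.lam) ≤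
      2 * (ch * Λ) * A * ((2 + 4 * D) * Λ) := by gcongr
  have b2 : cκ * P.h R T * (T : ℝ) ^ (1 - 1 / (2 * d)) ≤ cκ * (ch * Λ) * A := by gcongr
  have b3 : 2 * P.h R T * √(T * (2 * g2)) ≤ 2 * (ch * Λ) * (A * ((1 + 2 * D) * Λ)) := by gcongr
  have b4 : cκ * (ch * Λ) * A ≤ cκ * (ch * Λ) * A * Λ := le_mul_of_one_le_right (by positivity) hΛ
  have hc0 : 0 ≤ c := by positivity
  have hsum : P.cumRegret R T - ∑ t ∈ Finset.Icc 1 T, P.MR R t ≤ c * (Λ ^ 2 * A) := by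
    have : c * (Λ ^ 2 * A) = 2 * (ch * Λ) * A * ((2 + 4 * D) * Λ) + cκ * (ch * Λ) * A * Λ +
        2 * (ch * Λ) * (A * ((1 + 2 * D) * Λ)) := by rw [hc]; ring
    linarith
  rw [Real.norm_of_nonneg (le_max_right _ _), Real.norm_of_nonneg (by positivity)]
  exact max_le hsum (by positivity)

end Problem

section Model

variable {p r : ℕ} {H : Type*} [NormedAddCommGroup H] [InnerProductSpace ℝ H]

/-- The kernel is continuous on the context–arm space, so the kernel values of measurable contexts
and arms are measurable, although the feature map is arbitrary outside the space. -/
lemma measurable_inner_feat {P : Problem p r H} {L : ℝ≥0} (hLip : LipschitzOnWith L P.feat P.space)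
    {Ω : Type*} {m : MeasurableSpace Ω} {x x' : Ω → Vec p} {a a' : Ω → Vec r}
    (hx : Measurable x) (hx' : Measurable x') (ha : Measurable a) (ha' : Measurable a')
    (hz : ∀ ω, concat (x ω) (a ω) ∈ P.space) (hz' : ∀ ω, concat (x' ω) (a' ω) ∈ P.space) :
    Measurable fun ω => ⟪P.feat (concat (x ω) (a ω)), P.feat (concat (x' ω) (a' ω))⟫ := by
  set D : Set (Vec p × Vec r) := {y | concat y.1 y.2 ∈ P.space}
  have hcont : Continuous fun y : D => P.feat (concat y.1.1 y.1.2) := by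
    refine hLip.continuousOn.comp_continuous ?_ fun y => y.2
    exact (WithLp.prod_continuous_toLp 2 (Vec p) (Vec r)).comp continuous_subtype_val
  have hF : Measurable fun y : D × D =>
      ⟪P.feat (concat y.1.1.1 y.1.1.2), P.feat (concat y.2.1.1 y.2.1.2)⟫ :=
    ((hcont.comp continuous_fst).inner (hcont.comp continuous_snd)).measurable
  exact hF.comp (((hx.prodMk ha).subtype_mk (h := hz)).prodMk
    ((hx'.prodMk ha').subtype_mk (h := hz')))

end Model

end RobustBandit

/-! ### The regret bound for MinWD -/

theorem mainTheorem4 {p r : ℕ} (hd : 0 < p + r)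
    {H : Type*} [NormedAddCommGroup H] [InnerProductSpace ℝ H] [CompleteSpace H]
    (P : RobustBandit.Problem p r H) (L : ℝ≥0)
    (hlam : 1 ≤ P.lam) (hb : 0 ≤ P.b) (hδ₀ : 0 < P.delta) (hδ₁ : P.delta < 1)
    (hB : ‖P.theta‖ ≤ P.B) (hfeat : ∀ z ∈ P.space, ‖P.feat z‖ ≤ 1)
    (hLip : LipschitzOnWith L P.feat P.space)
    {Ω : Type*} {mΩ : MeasurableSpace Ω} (μ : Measure Ω) [IsProbabilityMeasure μ]
    (ℱ : Filtration ℕ mΩ) (R : Ω → RobustBandit.Run p r)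
    (hmodel : RobustBandit.IsSubGaussianModel μ ℱ P.b R)
    (htrue : ∀ ω t, 1 ≤ t → (R ω).x t ∈ P.region (R ω) t)
    (halg : ∀ ω, P.IsMinWD (R ω))
    (xd : Ω → ℕ → RobustBandit.Vec p) (ad : Ω → ℕ → RobustBandit.Vec r)
    (hcons : ∀ ω, P.IsConsidered (R ω) (xd ω) (ad ω)) :
    ∃ E : Set Ω, MeasurableSet E ∧ ENNReal.ofReal (1 - P.delta) ≤ μ E ∧ ∀ ω ∈ E,
      (∀ T : ℕ, 1 ≤ T → ∀ κ : ℝ, 0 ≤ κ → ∀ ε : ℝ, ε = RobustBandit.scale (p + r) κ T →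
        ∀ q : ℕ, q = RobustBandit.period (p + r) κ ε →
        ∀ C : Finset (RobustBandit.CtxArm p r), RobustBandit.IsCovering P.space ε C →
        RobustBandit.IsRecurrent κ ε C (R ω).z →
        (∃ ζ : ℕ → ℕ, RobustBandit.IsMatching ε C (R ω).z
            (fun t => RobustBandit.concat (xd ω t) (ad ω t)) q T ζ) ∧
        ∀ ζ : ℕ → ℕ, RobustBandit.IsMatching ε C (R ω).z
            (fun t => RobustBandit.concat (xd ω t) (ad ω t)) q T ζ →
          P.cumRegret (R ω) T ≤
            ∑ t ∈ Finset.Icc 1 T, P.MR (R ω) t +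
            2 * P.h (R ω) T * (T : ℝ) ^ (3 / 4 : ℝ) *
              Real.sqrt (4 * (P.dtilde (R ω) q T ζ : ℝ) *
                Real.log (1 + (T : ℝ) / ((P.dtilde (R ω) q T ζ : ℝ) * P.lam)) + 1 / P.lam) +
            4 * Real.sqrt (2 / P.lam) * (L : ℝ) * κ ^ (1 / ((p + r : ℕ) : ℝ)) * P.h (R ω) T *
              (T : ℝ) ^ (1 - 1 / (2 * ((p + r : ℕ) : ℝ))) +
            2 * P.h (R ω) T *
              Real.sqrt (2 * (T : ℝ) * (P.dbar (R ω) T : ℝ) *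
                Real.log (1 + (T : ℝ) / ((P.dbar (R ω) T : ℝ) * P.lam)))) ∧
      ((∃ κ : ℝ, 0 ≤ κ ∧ ∀ᶠ T : ℕ in atTop, ∃ C : Finset (RobustBandit.CtxArm p r),
          RobustBandit.IsCovering P.space (RobustBandit.scale (p + r) κ T) C ∧
          RobustBandit.IsRecurrent κ (RobustBandit.scale (p + r) κ T) C (R ω).z) →
        (∃ D : ℕ, ∀ T : ℕ, P.dbar (R ω) T ≤ D) →
        P.TypeIIRobust (R ω)) := by
  have hz : ∀ ω t, 1 ≤ t → (R ω).z t ∈ P.space := fun ω t ht =>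
    RobustBandit.Problem.mem_space (htrue ω) (halg ω) ht
  have hv : ∀ k, ∀ i ≤ k, ∀ j ≤ k,
      Measurable[ℱ k] fun ω => ⟪P.vec (R ω) i, P.vec (R ω) j⟫ := fun k i hi j hj =>
    RobustBandit.measurable_inner_feat hLip
      ((hmodel.measurable_x i).mono (ℱ.mono hi) le_rfl)
      ((hmodel.measurable_x j).mono (ℱ.mono hj) le_rfl)
      ((hmodel.measurable_a i).mono (ℱ.mono hi) le_rfl)
      ((hmodel.measurable_a j).mono (ℱ.mono hj) le_rfl)
      (fun ω => hz ω (i + 1) (by omega)) (fun ω => hz ω (j + 1) (by omega))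
  obtain ⟨hE1, hE2⟩ := RobustBandit.measure_selfNormalized_ge (μ := μ) ℱ
    (zero_lt_one.trans_le hlam) hb hδ₀ (v := fun i ω => P.vec (R ω) i)
    (N := fun i ω => (R ω).noise (i + 1)) hv hmodel.measurable_noise fun k =>
      ⟨(hmodel.measurable_noise k).mono (ℱ.le _) le_rfl, hmodel.integrable_exp k,
        hmodel.subGaussian k⟩
  refine ⟨{ω | P.NoiseBound (R ω)}, hE1, hE2, fun ω hω => ⟨?_, ?_⟩⟩
  · rintro T hT κ hκ _ rfl _ rfl C hC hrec
    refine ⟨hrec.exists_matching hC (fun t ht => ?_) T, fun ζ hζ => ?_⟩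
    · obtain ⟨⟨_, _, _, hxd, _⟩, had, _⟩ := hcons ω t ht
      exact ⟨_, hxd.1, _, had, rfl⟩
    · have h := RobustBandit.Problem.cumRegret_le_of_isMatching hd hlam hb hB hfeat hLip hω
        (htrue ω) (halg ω) (hcons ω) hT hκ hC hrec hζ
      simp only [RobustBandit.rankLog] at h
      convert h using 4
      · ring_nf
      · ring_nf
  · rintro ⟨κ, hκ, hrec⟩ ⟨D, hD⟩
    exact RobustBandit.Problem.typeIIRobust hd hlam hb hB hδ₀ hδ₁ hfeat hLip hω (htrue ω) (halg ω)
      (hcons ω) hκ hrec hD
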